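/- **Setting.** Let $\mathcal M_+(\mathbb R^+;1+\epsilon)$ be the set of nonnegative Radon measures $\mu$ on $\mathbb R^+=[0,\infty)$ with $\int(1+\epsilon)\,d\mu(\epsilon)<\infty$. Put $$\Phi=\min\{\sqrt{\epsilon_1},\sqrt{\epsilon_2},\sqrt{\epsilon_3},\sqrt{(\epsilon_1+\epsilon_2-\epsilon_3)_+}\},\qquad Q_\varphi=\varphi(\epsilon_3)+\varphi(\epsilon_1+\epsilon_2-\epsilon_3)-\varphi(\epsilon_1)-\varphi(\epsilon_2),$$ and let $W=\Phi/\sqrt{\epsilon_1\epsilon_2\epsilon_3}$ for $\epsilon_1,\epsilon_2,\epsilon_3>0$. When some $\epsilon_i=0$, $W$ has its limiting value: if exactly one of the three energies vanishes and $\epsilon_3<\epsilon_1+\epsilon_2$, then $W$ is the reciprocal of the square root of the product of the other two energies; otherwise $W=0$. (With this choice $W Q_\varphi$ is continuous up to the boundary for $\varphi\in C^2$.) For $T>0$ and $g_0\in\mathcal M_+(\mathbb R^+;1+\epsilon)$, a *weak solution on $(0,T)$ with initial datum $g_0$* of the equation for the energy density of the Nordheim (bosonic Boltzmann) equation is a family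 $(g(t))_{0\le t<T}$ in $\mathcal M_+(\mathbb R^+;1+\epsilon)$ that is weak-* continuous in $t$ ($\int(1+\epsilon)\,g(t,d\epsilon)$ is bounded on compact subintervals of $[0,T)$, and $t\mapsto\int\psi\,dg(t)$ is continuous on $[0,T)$ for every $\psi\in C_c([0,\infty))$) and satisfies, for every $\varphi\in C_c^2([0,T)\times[0,\infty))$, $$-\int g_0(d\epsilon)\varphi(0,\epsilon)=\int_0^T\!\!\int\partial_t\varphi\,g(t,d\epsilon)\,dt+\frac1{2^{5/2}}\int_0^T\!\!\iiint W Q_{\varphi(t,\cdot)}\,g(t,d\epsilon_1)g(t,d\epsilon_2)g(t,d\epsilon_3)\,dt+\frac{\pi}{2}\int_0^T\!\!\iint\!\int_0^\infty W\sqrt{\epsilon_3}\,Q_{\varphi(t,\cdot)}\,d\epsilon_3\,g(t,d\epsilon_1)g(t,d\epsilon_2)\,dt .$$ **Theorem.** There exists $\theta_*>0$ such that for all $M,E>0$ there is $T_0=T_0(M,E)>0$, and for every $\nu>0$ there are $\rho_0=\rho_0(M,E,\nu)>0$ and $K^*=K^*(M,E,\nu)>0$, with the following property. Let $g$ be any weak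 solution on $(0,T_0)$ with initial datum $g_0\in\mathcal M_+(\mathbb R^+;1+\epsilon)$ whose energy never exceeds the initial one, that is $\int\epsilon\,g(t,d\epsilon)\le\int\epsilon\,g_0(d\epsilon)$ for $0\le t<T_0$ (in particular, any weak solution that conserves mass and energy). Assume $$4\pi\sqrt2\int g_0(d\epsilon)=M,\qquad 4\pi\sqrt2\int\epsilon\,g_0(d\epsilon)=E,$$ $$\sup_{0<\rho\le\rho_0}\ \min\Big\{\inf_{0<R\le\rho}\frac{g_0([0,R])}{\nu R^{3/2}},\ \frac{g_0([0,\rho])}{K^*\rho^{\theta_*}}\Big\}\ge1 .$$ Then $$\sup_{0<t<T_0}g(t,\{0\})>0 .$$ -/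

import Mathlib

open MeasureTheory
open scoped NNReal ENNReal

namespace Nordheim

noncomputable section

/-- Membership of a nonnegative Borel measure on `[0, ∞)` in `𝓜₊(ℝ⁺; 1 + ε)`:
finite mass and finite energy. (Such a measure is finite, hence Radon.) -/
def FiniteMassEnergy (μ : Measure ℝ≥0) : Prop :=
  ∫⁻ ε, (1 + (ε : ℝ≥0∞)) ∂μ < ∞

/-- `Φ = min {√ε₁, √ε₂, √ε₃, √(ε₁ + ε₂ - ε₃)₊}` (the real square root vanishes on negative
numbers). -/
def Phi (ε₁ ε₂ ε₃ : ℝ) : ℝ :=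
  min (min (√ε₁) (√ε₂)) (min (√ε₃) (√(ε₁ + ε₂ - ε₃)))

/-- The kernel `Φ / √(ε₁ ε₂ ε₃)`. On the boundary of the octant, where this quotient reads `0 / 0`,
it is given its limiting value: if one energy vanishes and `ε₁ + ε₂ - ε₃ > 0`, then `√` of the
vanishing energy cancels and one over the square root of the product of the two other energies
remains (the other two summands below are zero); if two energies vanish, or if
`ε₁ + ε₂ - ε₃ ≤ 0`, the value is `0`. This is the choice for which the product with `Q` below is
continuous up to the boundary, so that an atom at `ε = 0` takes part in the collisions. -/
def kernel (ε₁ ε₂ ε₃ : ℝ) : ℝ :=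
  if 0 < ε₁ ∧ 0 < ε₂ ∧ 0 < ε₃ then Phi ε₁ ε₂ ε₃ / √(ε₁ * ε₂ * ε₃)
  else if ε₃ < ε₁ + ε₂ then 1 / √(ε₁ * ε₂ + ε₂ * ε₃ + ε₃ * ε₁)
  else 0

/-- `Q_φ`, symmetrized in the two variables `ε₁, ε₂` of the incoming particles. -/
def Q (φ : ℝ → ℝ) (ε₁ ε₂ ε₃ : ℝ) : ℝ :=
  φ ε₃ + φ (ε₁ + ε₂ - ε₃) - φ ε₁ - φ ε₂

/-- The cubic collision term `2^(-5/2) ∭ g₁ g₂ g₃ Φ / √(ε₁ ε₂ ε₃) Q_φ`. -/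
def cubicTerm (μ : Measure ℝ≥0) (φ : ℝ → ℝ) : ℝ :=
  1 / (2 : ℝ) ^ (5 / 2 : ℝ) *
    ∫ ε₁, ∫ ε₂, ∫ ε₃, kernel (ε₁ : ℝ) ε₂ ε₃ * Q φ ε₁ ε₂ ε₃ ∂μ ∂μ ∂μ

/-- The quadratic collision term `(π/2) ∭ g₁ g₂ Φ / √(ε₁ ε₂) Q_φ dε₃`, with
`Φ / √(ε₁ ε₂)` written as `kernel * √ε₃`; the variable `ε₃` carries Lebesgue measure. -/
def quadraticTerm (μ : Measure ℝ≥0) (φ : ℝ → ℝ) : ℝ :=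
  Real.pi / 2 *
    ∫ ε₁, ∫ ε₂, (∫ ε₃ in Set.Ioi (0 : ℝ), kernel (ε₁ : ℝ) ε₂ ε₃ * √ε₃ * Q φ ε₁ ε₂ ε₃) ∂μ ∂μ

/-- Test functions in `C²_c([0, T) × [0, ∞))`, given by an extension to the plane; they need not
vanish at `t = 0` or at `ε = 0`. -/
structure IsTestFunction (T : ℝ) (φ : ℝ → ℝ → ℝ) : Prop where
  contDiff : ContDiff ℝ 2 (fun p : ℝ × ℝ => φ p.1 p.2)
  hasCompactSupport : HasCompactSupport (fun p : ℝ × ℝ => φ p.1 p.2)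
  tsupport_subset : tsupport (fun p : ℝ × ℝ => φ p.1 p.2) ⊆ {p | p.1 < T}

/-- `g` is a weak solution on `(0, T)` with initial datum `g₀`. Only the values `g t`, `0 ≤ t < T`,
matter. Continuity in time is required only in the weak-* sense (bounded mass and energy on compact
time intervals, and continuity against compactly supported continuous functions). -/
structure IsWeakSolution (T : ℝ) (g₀ : Measure ℝ≥0) (g : ℝ → Measure ℝ≥0) : Prop where
  initial : FiniteMassEnergy g₀
  locally_bounded : ∀ T' < T, ∃ C : ℝ≥0, ∀ t ∈ Set.Icc 0 T',
    ∫⁻ ε, (1 + (ε : ℝ≥0∞)) ∂(g t) ≤ C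
  continuous : ∀ ψ : ℝ≥0 → ℝ, Continuous ψ → HasCompactSupport ψ →
    ContinuousOn (fun t => ∫ ε, ψ ε ∂(g t)) (Set.Ico 0 T)
  weak_identity : ∀ φ : ℝ → ℝ → ℝ, IsTestFunction T φ →
    -∫ ε, φ 0 (ε : ℝ) ∂g₀ =
      (∫ t in Set.Ioo 0 T, ∫ ε, deriv (fun s => φ s (ε : ℝ)) t ∂(g t))
      + (∫ t in Set.Ioo 0 T, cubicTerm (g t) (φ t))
      + ∫ t in Set.Ioo 0 T, quadraticTerm (g t) (φ t)

/-- The local concentration condition at zero energy: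
`sup_{0 < ρ ≤ ρ₀} min { inf_{0 < R ≤ ρ} g₀([0,R]) / (ν R^(3/2)), g₀([0,ρ]) / (K ρ^θ) } ≥ 1`. -/
def Concentrated (θ ν ρ₀ K : ℝ) (g₀ : Measure ℝ≥0) : Prop :=
  1 ≤ ⨆ ρ ∈ Set.Ioc 0 ρ₀,
    min (⨅ R ∈ Set.Ioc 0 ρ,
          g₀ {ε | (ε : ℝ) ≤ R} / ENNReal.ofReal (ν * R ^ (3 / 2 : ℝ)))
      (g₀ {ε | (ε : ℝ) ≤ ρ} / ENNReal.ofReal (K * ρ ^ θ))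

end

end Nordheim

/-!
# Condensation for the Nordheim equation from concentrated initial data

Test the equation with the convex decreasing profiles `(1 - ε / R)₊³`, which measure the mass in
`[0, R]`. Summed over the three choices of the outgoing energy, the cubic integrand against a convex
function is nonnegative (`cyclicSum_nonneg`), while the quadratic term removes mass at a rate at
most proportional to the mass already tested (`neg_le_quadraticTerm_profile`). The constant of
proportionality depends on mass and energy only, because the mass of a weak solution never exceeds
its initial value (`IsWeakSolution.mass_le`). Hence, after multiplication by an exponential in time,
the mass near zero is nondecreasing at every scale `R ≤ 1` (`IsWeakSolution.gaugedMass_mono`).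

The cubic term also yields growth. If a mass `d` lies in `(R, ρ]`, some interval of length `R / 4`
carries a fraction of order `R / ρ` of it. Two particles from this interval and one in `[0, R / 2]`
produce a particle below `R`, so that the mass in `[0, R]` grows at a rate proportional to the mass
in `[0, R / 2]`, with factor of order `R² d² / ρ³` (`le_cubicTerm_profile`). Here the lower bound
`ν R^(3/2)` on the initial mass serves as a seed: with `ρ = x⁴⁴` and `R` of order `x⁴⁶`, two rounds
of growth within a time `x` would produce a mass of order `1 / x`, more than the total mass, unless
all but a fraction `x` of the mass in `[0, ρ]` enters `[0, R]` during that time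
(`IsWeakSolution.concentration_step`).

This step is iterated along `x = σ / 2 ^ k`, starting from `σ ^ 44 = 2 ρ` and a mass of order `σ`,
which is where `θ = 1 / 44` comes from. Both the waiting times and the relative losses of mass are
geometric series, so that before time `1 / 2` a fixed amount of mass has entered all the intervals
`[0, (σ / 2 ^ k) ^ 44]` (`IsWeakSolution.iteration`), and by monotonicity it is found at zero at
time `1 / 2`. Thus `T₀ = 1` is admissible for all `M` and `E`.
-/

namespace Nordheim

/-! ### The convex profile -/

theorem hasDerivAt_max_zero_sq (x : ℝ) : HasDerivAt (fun y : ℝ => max y 0 ^ 2) (2 * max x 0) x := by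
  rcases lt_trichotomy x 0 with hx | rfl | hx
  · rw [max_eq_right hx.le, mul_zero]
    refine (hasDerivAt_const x (0 : ℝ)).congr_of_eventuallyEq ?_
    filter_upwards [gt_mem_nhds hx] with y hy
    simp [max_eq_right hy.le]
  · rw [max_self, mul_zero, hasDerivAt_iff_isLittleO_nhds_zero]
    simp only [zero_add, max_self, smul_zero, sub_zero]
    rw [Asymptotics.isLittleO_iff]
    intro c hc
    filter_upwards [Metric.ball_mem_nhds (0 : ℝ) hc] with y hy
    rw [mem_ball_zero_iff, Real.norm_eq_abs] at hy
    have h1 : |max y 0| ≤ |y| := by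
      rw [abs_of_nonneg (le_max_right y 0)]
      exact max_le (le_abs_self y) (abs_nonneg y)
    simp only [ne_eq, OfNat.ofNat_ne_zero, not_false_eq_true, zero_pow, sub_zero, norm_pow,
      Real.norm_eq_abs]
    nlinarith [abs_nonneg y, abs_nonneg (max y 0)]
  · rw [max_eq_left hx.le]
    have h := hasDerivAt_pow 2 x
    refine (h.congr_of_eventuallyEq ?_).congr_deriv (by simp)
    filter_upwards [lt_mem_nhds hx] with y hy
    simp [max_eq_left hy.le]

theorem hasDerivAt_max_zero_cube (x : ℝ) :
    HasDerivAt (fun y : ℝ => max y 0 ^ 3) (3 * max x 0 ^ 2) x := by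
  have h := (hasDerivAt_id x).mul (hasDerivAt_max_zero_sq x)
  refine (h.congr_of_eventuallyEq (Filter.Eventually.of_forall fun y => ?_)).congr_deriv ?_
  · rcases le_total y 0 with hy | hy
    · simp [hy]
    · simp [hy]; ring
  · rcases le_total x 0 with hy | hy
    · simp [hy]
    · simp [hy]; ring

theorem contDiff_max_zero_cube : ContDiff ℝ 2 (fun y : ℝ => max y 0 ^ 3) := by
  have h3 : deriv (fun y : ℝ => max y 0 ^ 3) = fun y => 3 * max y 0 ^ 2 :=
    funext fun x => (hasDerivAt_max_zero_cube x).deriv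
  have h2 : deriv (fun y : ℝ => max y 0 ^ 2) = fun y => 2 * max y 0 :=
    funext fun x => (hasDerivAt_max_zero_sq x).deriv
  have h1 : ContDiff ℝ 1 (fun y : ℝ => max y 0 ^ 2) := by
    rw [contDiff_one_iff_deriv, h2]
    exact ⟨fun x => (hasDerivAt_max_zero_sq x).differentiableAt, by fun_prop⟩
  rw [show (2 : WithTop ℕ∞) = 1 + 1 from (one_add_one_eq_two).symm, contDiff_succ_iff_deriv, h3]
  refine ⟨fun x => (hasDerivAt_max_zero_cube x).differentiableAt, by simp, contDiff_const.mul h1⟩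

/-- The profile `(1 - x / R)₊³`: twice continuously differentiable, convex, decreasing and
supported on `x ≤ R`. Integrated against `g`, it is a smoothed version of `g([0, R])`. -/
noncomputable def profile (R x : ℝ) : ℝ := max (1 - x / R) 0 ^ 3

theorem profile_nonneg (R x : ℝ) : 0 ≤ profile R x := pow_nonneg (le_max_right _ _) 3

theorem profile_eq_zero {R x : ℝ} (hR : 0 < R) (hx : R ≤ x) : profile R x = 0 := by
  have : 1 - x / R ≤ 0 := by rw [sub_nonpos, le_div_iff₀ hR]; linarith
  simp [profile, this]

theorem max_one_sub_div_le_one {R x : ℝ} (hR : 0 < R) (hx : 0 ≤ x) : max (1 - x / R) 0 ≤ 1 :=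
  max_le (by have := div_nonneg hx hR.le; linarith) zero_le_one

theorem profile_le_one {R x : ℝ} (hR : 0 < R) (hx : 0 ≤ x) : profile R x ≤ 1 :=
  pow_le_one₀ (le_max_right _ _) (max_one_sub_div_le_one hR hx)

theorem le_profile {R x : ℝ} (r : ℝ) (hR : 0 < R) (hr : r ≤ R) (hx : x ≤ r) :
    (1 - r / R) ^ 3 ≤ profile R x := by
  have h0 : 0 ≤ 1 - r / R := by rw [sub_nonneg, div_le_one hR]; exact hr
  unfold profile
  gcongr
  exact le_max_of_le_left (by gcongr)

theorem hasDerivAt_profile (R x : ℝ) :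
    HasDerivAt (profile R) (-(3 / R) * max (1 - x / R) 0 ^ 2) x := by
  have h1 : HasDerivAt (fun y : ℝ => 1 - y / R) (-(1 / R)) x := by
    simpa using ((hasDerivAt_id x).div_const R).const_sub 1
  have h2 := (hasDerivAt_max_zero_cube (1 - x / R)).comp x h1
  exact h2.congr_deriv (by ring)

theorem continuous_profile (R : ℝ) : Continuous (profile R) := by unfold profile; fun_prop

theorem contDiff_profile (R : ℝ) : ContDiff ℝ 2 (profile R) :=
  contDiff_max_zero_cube.comp (contDiff_const.sub (contDiff_id.div_const R))

theorem convexOn_profile {R : ℝ} (hR : 0 < R) : ConvexOn ℝ Set.univ (profile R) := by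
  refine MonotoneOn.convexOn_of_deriv convex_univ (continuous_profile R).continuousOn
    (fun x _ => (hasDerivAt_profile R x).differentiableAt.differentiableWithinAt) ?_
  intro x _ y _ hxy
  rw [(hasDerivAt_profile R x).deriv, (hasDerivAt_profile R y).deriv]
  have h1 : max (1 - y / R) 0 ≤ max (1 - x / R) 0 := by gcongr
  have h2 : max (1 - y / R) 0 ^ 2 ≤ max (1 - x / R) 0 ^ 2 := by gcongr
  have h3 : 0 < 3 / R := by positivity
  nlinarith

theorem abs_max_zero_sub_le (R x y : ℝ) (hR : 0 < R) :
    |max (1 - x / R) 0 - max (1 - y / R) 0| ≤ |x - y| / R := by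
  have h := abs_max_sub_max_le_abs (1 - x / R) (1 - y / R) 0
  rwa [show 1 - x / R - (1 - y / R) = -((x - y) / R) by ring, abs_neg, abs_div,
    abs_of_pos hR] at h

theorem abs_profile_sub_le {R x y : ℝ} (hR : 0 < R) (hx : 0 ≤ x) (hy : 0 ≤ y) :
    |profile R x - profile R y| ≤ 3 / R * |x - y| := by
  have h := abs_max_zero_sub_le R x y hR
  have hx1 := max_one_sub_div_le_one hR hx
  have hy1 := max_one_sub_div_le_one hR hy
  have hx0 := le_max_right (1 - x / R) 0
  have hy0 := le_max_right (1 - y / R) 0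
  unfold profile
  generalize max (1 - x / R) 0 = p at *
  generalize max (1 - y / R) 0 = q at *
  have e : p ^ 3 - q ^ 3 = (p ^ 2 + p * q + q ^ 2) * (p - q) := by ring
  have h3 : p ^ 2 + p * q + q ^ 2 ≤ 3 := by nlinarith
  rw [e, abs_mul, abs_of_nonneg (by positivity : 0 ≤ p ^ 2 + p * q + q ^ 2)]
  calc _ ≤ 3 * (|x - y| / R) := mul_le_mul h3 h (abs_nonneg _) (by norm_num)
    _ = _ := by ring

/-- The collision difference of the profile is controlled by the product of the two energy
transfers, because the second derivative of the profile is at most `6 / R²`. -/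
theorem abs_profile_collision_le {R a b c d : ℝ} (hR : 0 < R) (ha : 0 ≤ a) (hb : 0 ≤ b)
    (hc : 0 ≤ c) (hd : 0 ≤ d) (h : a + b = c + d) :
    |profile R c + profile R d - profile R a - profile R b| ≤
      6 / R ^ 2 * (|a - c| * |b - c|) := by
  set k : ℝ → ℝ := fun u => profile R (u + (c - a)) - profile R u with hk
  set k' : ℝ → ℝ := fun u => -(3 / R) * max (1 - (u + (c - a)) / R) 0 ^ 2 -
    -(3 / R) * max (1 - u / R) 0 ^ 2 with hk'
  have hderiv : ∀ u ∈ {u : ℝ | 0 ≤ u ∧ 0 ≤ u + (c - a)},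
      HasDerivWithinAt k (k' u) {u : ℝ | 0 ≤ u ∧ 0 ≤ u + (c - a)} u := fun u _ =>
    (((hasDerivAt_profile R (u + (c - a))).comp_add_const u (c - a)).sub
      (hasDerivAt_profile R u)).hasDerivWithinAt
  have hbound : ∀ u ∈ {u : ℝ | 0 ≤ u ∧ 0 ≤ u + (c - a)}, ‖k' u‖ ≤ 6 / R ^ 2 * |a - c| := by
    rintro u ⟨hu, hu'⟩
    have h1 := abs_max_zero_sub_le R (u + (c - a)) u hR
    have hx1 := max_one_sub_div_le_one hR hu
    have hy1 := max_one_sub_div_le_one hR hu'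
    have hx0 := le_max_right (1 - u / R) 0
    have hy0 := le_max_right (1 - (u + (c - a)) / R) 0
    rw [show u + (c - a) - u = -(a - c) by ring, abs_neg] at h1
    simp only [hk', Real.norm_eq_abs]
    generalize max (1 - u / R) 0 = p at *
    generalize max (1 - (u + (c - a)) / R) 0 = q at *
    rw [show -(3 / R) * q ^ 2 - -(3 / R) * p ^ 2 = -(3 / R * ((q + p) * (q - p))) by ring, abs_neg,
      abs_mul, abs_mul, abs_of_nonneg (by positivity : 0 ≤ 3 / R),
      abs_of_nonneg (by positivity : 0 ≤ q + p)]
    calc _ ≤ 3 / R * (2 * (|a - c| / R)) := by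
          gcongr
          linarith
      _ = _ := by field_simp; ring
  have hconv : Convex ℝ {u : ℝ | 0 ≤ u ∧ 0 ≤ u + (c - a)} := by
    have : {u : ℝ | 0 ≤ u ∧ 0 ≤ u + (c - a)} = Set.Ici 0 ∩ Set.Ici (a - c) := by
      ext u
      simp only [Set.mem_ofPred_eq, Set.mem_inter_iff, Set.mem_Ici]
      constructor <;> rintro ⟨h1, h2⟩ <;> exact ⟨h1, by linarith⟩
    rw [this]
    exact (convex_Ici 0).inter (convex_Ici _)
  have hda : d + (c - a) = b := by linarith
  have key := hconv.norm_image_sub_le_of_norm_hasDerivWithin_le hderiv hbound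
    (x := d) (y := a) ⟨hd, by linarith⟩ ⟨ha, by linarith⟩
  simp only [hk, Real.norm_eq_abs] at key
  rw [show a + (c - a) = c by ring, hda, show a - d = -(b - c) by linarith, abs_neg] at key
  calc _ = |profile R c - profile R a - (profile R b - profile R d)| := by congr 1; ring
    _ ≤ _ := key
    _ = _ := by ring

/-- Two points with the same sum and lying further apart give a larger sum of values of a convex
function. -/
theorem add_le_add_of_convexOn {φ : ℝ → ℝ} (hφ : ConvexOn ℝ Set.univ φ) {a b c d : ℝ}
    (h : a + b = c + d) (hca : c ≤ a) (had : a ≤ d) : φ a + φ b ≤ φ c + φ d := by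
  rcases eq_or_lt_of_le (hca.trans had) with hcd | hcd
  · have h1 : a = c := by linarith
    have h2 : b = d := by linarith
    rw [h1, h2]
  have hpos : 0 < d - c := by linarith
  have ht : 0 ≤ (a - c) / (d - c) := div_nonneg (by linarith) hpos.le
  have ht' : 0 ≤ (d - a) / (d - c) := div_nonneg (by linarith) hpos.le
  have hs : (d - a) / (d - c) + (a - c) / (d - c) = 1 := by field_simp; ring
  have h1 := hφ.2 (Set.mem_univ c) (Set.mem_univ d) ht' ht hs
  have h2 := hφ.2 (Set.mem_univ c) (Set.mem_univ d) ht ht' (by rw [add_comm]; exact hs)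
  simp only [smul_eq_mul] at h1 h2
  have e1 : (d - a) / (d - c) * c + (a - c) / (d - c) * d = a := by field_simp; ring
  have e2 : (a - c) / (d - c) * c + (d - a) / (d - c) * d = b := by
    have : b = c + d - a := by linarith
    rw [this]; field_simp; ring
  rw [e1] at h1
  rw [e2] at h2
  have : (d - a) / (d - c) * φ c + (a - c) / (d - c) * φ d +
      ((a - c) / (d - c) * φ c + (d - a) / (d - c) * φ d) = φ c + φ d := by
    have e : (d - a) / (d - c) = 1 - (a - c) / (d - c) := by linarith
    rw [e]; ring
  linarith

/-! ### The collision kernel -/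

theorem Phi_nonneg (a b c : ℝ) : 0 ≤ Phi a b c := by
  unfold Phi; positivity

theorem kernel_nonneg (a b c : ℝ) : 0 ≤ kernel a b c := by
  unfold kernel
  split_ifs
  · exact div_nonneg (Phi_nonneg a b c) (Real.sqrt_nonneg _)
  · positivity
  · exact le_rfl

theorem kernel_comm (a b c : ℝ) : kernel a b c = kernel b a c := by
  have h1 : Phi a b c = Phi b a c := by
    unfold Phi; rw [min_comm (√a), add_comm a b]
  unfold kernel
  rw [h1, mul_comm a b, add_comm a b,
    show b * a + b * c + c * a = b * a + a * c + c * b by ring]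
  congr 1
  exact propext ⟨fun h => ⟨h.2.1, h.1, h.2.2⟩, fun h => ⟨h.2.1, h.1, h.2.2⟩⟩

theorem Q_comm (φ : ℝ → ℝ) (a b c : ℝ) : Q φ a b c = Q φ b a c := by
  unfold Q; rw [add_comm a b]; ring

/-- There is no collision producing more energy than available. -/
theorem kernel_eq_zero {a b c : ℝ} (h : a + b ≤ c) : kernel a b c = 0 := by
  unfold kernel
  split_ifs with h1 h2
  · have : √(a + b - c) = 0 := Real.sqrt_eq_zero_of_nonpos (by linarith)
    unfold Phi
    rw [this, min_eq_right (Real.sqrt_nonneg c), min_eq_right (by positivity), zero_div]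
  · linarith
  · rfl

/-- A kernel bound with the quotient cleared: `p` is one of the energies and `q` the product of
the two others. -/
theorem kernel_mul_sqrt_le_aux {a b c p q : ℝ} (ha : 0 ≤ a) (hb : 0 ≤ b) (hc : 0 ≤ c)
    (hp : Phi a b c ≤ √p) (hp0 : 0 ≤ p) (hpq : a * b * c = p * q)
    (hq : q ≤ a * b + b * c + c * a) : kernel a b c * √q ≤ 1 := by
  unfold kernel
  split_ifs with h1 h2
  · have hpos : 0 < √(a * b * c) := Real.sqrt_pos.2 (mul_pos (mul_pos h1.1 h1.2.1) h1.2.2)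
    rw [div_mul_eq_mul_div, div_le_one hpos, hpq, Real.sqrt_mul hp0]
    gcongr
  · rcases eq_or_lt_of_le (by positivity : 0 ≤ a * b + b * c + c * a) with h | h
    · simp [← h]
    · rw [one_div_mul_eq_div, div_le_one (Real.sqrt_pos.2 h)]
      exact Real.sqrt_le_sqrt hq
  · simp

theorem kernel_mul_sqrt_mul_left {a b c : ℝ} (ha : 0 ≤ a) (hb : 0 ≤ b) (hc : 0 ≤ c) :
    kernel a b c * √(a * b) ≤ 1 :=
  kernel_mul_sqrt_le_aux ha hb hc ((min_le_right _ _).trans (min_le_left _ _)) hc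
    (by ring) (by nlinarith [mul_nonneg hb hc, mul_nonneg hc ha])

theorem kernel_mul_sqrt_mul_right {a b c : ℝ} (ha : 0 ≤ a) (hb : 0 ≤ b) (hc : 0 ≤ c) :
    kernel a b c * √(b * c) ≤ 1 :=
  kernel_mul_sqrt_le_aux ha hb hc ((min_le_left _ _).trans (min_le_left _ _)) ha
    (by ring) (by nlinarith [mul_nonneg ha hb, mul_nonneg hc ha])

theorem kernel_mul_sqrt_mul_outer {a b c : ℝ} (ha : 0 ≤ a) (hb : 0 ≤ b) (hc : 0 ≤ c) :
    kernel a b c * √(a * c) ≤ 1 := by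
  rw [kernel_comm]; exact kernel_mul_sqrt_mul_right hb ha hc

/-- When the two incoming energies are the two larger ones, the kernel is the reciprocal of
the square root of their product. -/
theorem kernel_of_le_le {x y z : ℝ} (hx : 0 ≤ x) (hxy : x ≤ y) (hyz : y ≤ z) (hy : 0 < y) :
    kernel y z x = 1 / √(y * z) := by
  have hz : 0 < z := hy.trans_le hyz
  rcases hx.eq_or_lt with rfl | hx
  · unfold kernel
    rw [if_neg (by simp), if_pos (by positivity)]
    simp
  · unfold kernel
    rw [if_pos ⟨hy, hz, hx⟩]
    have : Phi y z x = √x := by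
      unfold Phi
      rw [min_eq_left (a := √x) (Real.sqrt_le_sqrt (by linarith))]
      exact min_eq_right (le_min (Real.sqrt_le_sqrt hxy) (Real.sqrt_le_sqrt (hxy.trans hyz)))
    rw [this, Real.sqrt_mul (by positivity), mul_comm, ← div_div,
      div_self (Real.sqrt_pos.2 hx).ne']

/-- When the outgoing energy lies between the two incoming ones, the kernel is the reciprocal of
the square root of the product of the two larger energies. -/
theorem kernel_of_le_of_le {x y z : ℝ} (hx : 0 ≤ x) (hxy : x ≤ y) (hyz : y ≤ z) (hy : 0 < y)
    (h : 0 < x ∨ y < z) : kernel x z y = 1 / √(y * z) := by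
  have hz : 0 < z := hy.trans_le hyz
  rcases hx.eq_or_lt with rfl | hx
  · have hyz' : y < z := h.resolve_left (lt_irrefl _)
    unfold kernel
    rw [if_neg (by simp), if_pos (by linarith)]
    simp [mul_comm]
  · unfold kernel
    rw [if_pos ⟨hx, hz, hy⟩]
    have : Phi x z y = √x := by
      unfold Phi
      rw [min_eq_left (a := √x) (Real.sqrt_le_sqrt (by linarith))]
      exact min_eq_left (le_min (Real.sqrt_le_sqrt hxy) (Real.sqrt_le_sqrt (by linarith)))
    rw [this, show x * z * y = x * (y * z) by ring, Real.sqrt_mul hx.le, ← div_div,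
      div_self (Real.sqrt_pos.2 hx).ne']

/-! ### Pointwise bounds on the cubic integrand -/

theorem abs_Q_profile_le_two {R a b c : ℝ} (hR : 0 < R) (ha : 0 ≤ a) (hb : 0 ≤ b) (hc : 0 ≤ c)
    (h : c ≤ a + b) : |Q (profile R) a b c| ≤ 2 := by
  have hd : 0 ≤ a + b - c := by linarith
  have := profile_nonneg R a
  have := profile_nonneg R b
  have := profile_nonneg R c
  have := profile_nonneg R (a + b - c)
  have := profile_le_one hR ha
  have := profile_le_one hR hb
  have := profile_le_one hR hc
  have := profile_le_one hR hd
  unfold Q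
  rw [abs_le]
  constructor <;> linarith

/-- The product of the two energy transfers of an admissible collision is at most the product of
two of the energies, so that the singularity of the kernel is compensated by `Q`. -/
theorem exists_transfer_le {a b c : ℝ} (ha : 0 ≤ a) (hb : 0 ≤ b) (hc : 0 ≤ c) (h : c ≤ a + b) :
    ∃ P, 0 ≤ P ∧ kernel a b c * √P ≤ 1 ∧ |a - c| * |b - c| ≤ P := by
  rcases le_total a c with h1 | h1 <;> rcases le_total b c with h2 | h2
  · refine ⟨a * b, by positivity, kernel_mul_sqrt_mul_left ha hb hc, ?_⟩
    rw [abs_of_nonpos (by linarith), abs_of_nonpos (by linarith), mul_comm a b]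
    exact mul_le_mul (by linarith) (by linarith) (by linarith) hb
  · refine ⟨b * c, by positivity, kernel_mul_sqrt_mul_right ha hb hc, ?_⟩
    rw [abs_of_nonpos (by linarith), abs_of_nonneg (by linarith), mul_comm b c]
    exact mul_le_mul (by linarith) (by linarith) (by linarith) hc
  · refine ⟨a * c, by positivity, kernel_mul_sqrt_mul_outer ha hb hc, ?_⟩
    rw [abs_of_nonneg (by linarith), abs_of_nonpos (by linarith)]
    exact mul_le_mul (by linarith) (by linarith) (by linarith) ha
  · refine ⟨a * b, by positivity, kernel_mul_sqrt_mul_left ha hb hc, ?_⟩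
    rw [abs_of_nonneg (by linarith), abs_of_nonneg (by linarith)]
    exact mul_le_mul (by linarith) (by linarith) (by linarith) ha

/-- Interpolating between `|Q| ≤ 2` and the second order bound makes the cubic integrand bounded,
uniformly in the energies and vanishing as `R → ∞`. -/
theorem abs_kernel_mul_Q_profile_le {R a b c : ℝ} (hR : 0 < R) (ha : 0 ≤ a) (hb : 0 ≤ b)
    (hc : 0 ≤ c) : |kernel a b c * Q (profile R) a b c| ≤ 4 / R := by
  rcases le_total (a + b) c with h | h
  · rw [kernel_eq_zero h, zero_mul, abs_zero]; positivity
  obtain ⟨P, hP, hW, hab⟩ := exists_transfer_le ha hb hc h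
  have h2 := abs_Q_profile_le_two hR ha hb hc h
  have h6 : |Q (profile R) a b c| ≤ 6 / R ^ 2 * P :=
    (abs_profile_collision_le hR ha hb hc (by linarith : 0 ≤ a + b - c) (by ring)).trans
      (by gcongr)
  have hW0 := kernel_nonneg a b c
  refine abs_le_of_sq_le_sq (b := 4 / R) ?_ (by positivity)
  have hW2 : kernel a b c ^ 2 * P ≤ 1 := by
    have := pow_le_one₀ (n := 2) (by positivity) hW
    rwa [mul_pow, Real.sq_sqrt hP] at this
  calc (kernel a b c * Q (profile R) a b c) ^ 2
      = kernel a b c ^ 2 * (|Q (profile R) a b c| * |Q (profile R) a b c|) := by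
        rw [mul_pow, ← sq_abs (Q _ a b c)]; ring
    _ ≤ kernel a b c ^ 2 * (2 * (6 / R ^ 2 * P)) := by gcongr
    _ = 12 / R ^ 2 * (kernel a b c ^ 2 * P) := by ring
    _ ≤ 12 / R ^ 2 * 1 := by gcongr
    _ ≤ (4 / R) ^ 2 := by rw [div_pow, mul_one]; gcongr; norm_num

/-- The cubic integrand summed over the three choices of the outgoing energy. -/
noncomputable def cyclicSum (φ : ℝ → ℝ) (x y z : ℝ) : ℝ :=
  kernel x y z * Q φ x y z + kernel y z x * Q φ y z x + kernel z x y * Q φ z x y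

theorem cyclicSum_rotate (φ : ℝ → ℝ) (x y z : ℝ) : cyclicSum φ x y z = cyclicSum φ y z x := by
  unfold cyclicSum; ring

theorem cyclicSum_swap (φ : ℝ → ℝ) (x y z : ℝ) : cyclicSum φ x y z = cyclicSum φ y x z := by
  unfold cyclicSum
  rw [kernel_comm y x z, Q_comm φ y x z, kernel_comm x z y, Q_comm φ x z y,
    kernel_comm z y x, Q_comm φ z y x]
  ring

/-- For ordered energies, the cyclic sum dominates the second difference of `φ` at the largest
energy; the collision producing the largest energy contributes a nonnegative amount. -/
theorem le_cyclicSum {φ : ℝ → ℝ} (hφ : ConvexOn ℝ Set.univ φ) {x y z : ℝ} (hx : 0 ≤ x)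
    (hxy : x ≤ y) (hyz : y ≤ z) (hy : 0 < y) :
    1 / √(y * z) * (φ (z + x - y) + φ (z + y - x) - 2 * φ z) ≤ cyclicSum φ x y z := by
  have h1 : 0 ≤ kernel x y z * Q φ x y z := by
    rcases le_total (x + y) z with h | h
    · rw [kernel_eq_zero h, zero_mul]
    · refine mul_nonneg (kernel_nonneg _ _ _) ?_
      have := add_le_add_of_convexOn hφ (a := x) (b := y) (c := x + y - z) (d := z)
        (by ring) (by linarith) (by linarith)
      unfold Q; linarith
  have h3 : kernel z x y * Q φ z x y = 1 / √(y * z) * Q φ z x y := by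
    by_cases h : 0 < x ∨ y < z
    · rw [kernel_comm, kernel_of_le_of_le hx hxy hyz hy h]
    -- for `x = 0` and `y = z` the kernel takes its boundary value `0`, but `Q` vanishes as well
    · push Not at h
      have hx0 : x = 0 := le_antisymm h.1 hx
      have hyz' : y = z := le_antisymm hyz h.2
      have : Q φ z x y = 0 := by
        unfold Q; rw [hx0, hyz']; simp
      rw [this, mul_zero, mul_zero]
  have hs : 1 / √(y * z) * (φ (z + x - y) + φ (z + y - x) - 2 * φ z) =
      1 / √(y * z) * Q φ y z x + 1 / √(y * z) * Q φ z x y := by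
    unfold Q; rw [add_comm y z]; ring
  unfold cyclicSum
  rw [h3, kernel_of_le_le hx hxy hyz hy, hs]
  linarith

theorem cyclicSum_nonneg_of_le {φ : ℝ → ℝ} (hφ : ConvexOn ℝ Set.univ φ) {x y z : ℝ} (hx : 0 ≤ x)
    (hxy : x ≤ y) (hyz : y ≤ z) : 0 ≤ cyclicSum φ x y z := by
  rcases (hx.trans hxy).eq_or_lt with hy | hy
  · have hx0 : x = 0 := by linarith
    subst hx0
    rw [← hy]
    have hz : 0 ≤ z := by linarith
    have h1 : kernel 0 0 z = 0 := kernel_eq_zero (by linarith)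
    have h2 : kernel 0 z 0 = 0 := by
      unfold kernel; simp
    have h3 : kernel z 0 0 = 0 := by rw [kernel_comm, h2]
    simp [cyclicSum, h1, h2, h3]
  · refine le_trans ?_ (le_cyclicSum hφ hx hxy hyz hy)
    have := add_le_add_of_convexOn hφ (a := z) (b := z) (c := z + x - y) (d := z + y - x)
        (by ring) (by linarith) (by linarith)
    exact mul_nonneg (by positivity) (by linarith)

theorem cyclicSum_nonneg {φ : ℝ → ℝ} (hφ : ConvexOn ℝ Set.univ φ) {x y z : ℝ} (hx : 0 ≤ x)
    (hy : 0 ≤ y) (hz : 0 ≤ z) : 0 ≤ cyclicSum φ x y z := by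
  rcases le_total x y with h1 | h1 <;> rcases le_total y z with h2 | h2 <;>
    rcases le_total x z with h3 | h3
  · exact cyclicSum_nonneg_of_le hφ hx h1 h2
  · exact cyclicSum_nonneg_of_le hφ hx h1 h2
  · rw [cyclicSum_swap, cyclicSum_rotate]; exact cyclicSum_nonneg_of_le hφ hx h3 h2
  · rw [cyclicSum_rotate, cyclicSum_rotate]; exact cyclicSum_nonneg_of_le hφ hz h3 h1
  · rw [cyclicSum_swap]; exact cyclicSum_nonneg_of_le hφ hy h1 h3
  · rw [cyclicSum_rotate]; exact cyclicSum_nonneg_of_le hφ hy h2 h3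
  · rw [cyclicSum_rotate, cyclicSum_swap]; exact cyclicSum_nonneg_of_le hφ hz h2 h1
  · rw [cyclicSum_rotate, cyclicSum_swap]; exact cyclicSum_nonneg_of_le hφ hz h2 h1

/-- Two nearby particles of energy between `R` and `ρ` and one of energy at most `R / 2` produce
particles of energy below `R` at a definite rate. -/
theorem le_cyclicSum_profile {R ρ x y z : ℝ} (hR : 0 < R) (hx : 0 ≤ x) (hxR : x ≤ R / 2)
    (hy : R ≤ y) (hyρ : y ≤ ρ) (hz : R ≤ z) (hzρ : z ≤ ρ) (h : |y - z| ≤ R / 4) :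
    1 / (64 * ρ) ≤ cyclicSum (profile R) x y z := by
  wlog hyz : y ≤ z generalizing y z
  · have := this hz hzρ hy hyρ (by rwa [abs_sub_comm]) (le_of_not_ge hyz)
    rwa [cyclicSum_swap, cyclicSum_rotate]
  have hy0 : 0 < y := hR.trans_le hy
  have hρ : 0 < ρ := by linarith
  refine le_trans ?_ (le_cyclicSum (convexOn_profile hR) hx (by linarith) hyz hy0)
  have h1 : (1 - (3 * R / 4) / R) ^ 3 ≤ profile R (z + x - y) := by
    refine le_profile _ hR (by linarith) ?_
    have := (abs_le.1 h).1
    linarith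
  have h2 : 1 - (3 * R / 4) / R = 1 / 4 := by field_simp; norm_num
  have h3 : √(y * z) ≤ ρ := by
    rw [Real.sqrt_le_left hρ.le, sq]
    exact mul_le_mul hyρ hzρ (by linarith) hρ.le
  have h4 : 0 < √(y * z) := Real.sqrt_pos.2 (mul_pos hy0 (by linarith))
  rw [h2] at h1
  rw [profile_eq_zero hR hz]
  have h5 := profile_nonneg R (z + y - x)
  calc 1 / (64 * ρ) = 1 / ρ * (1 / 4) ^ 3 := by field_simp; norm_num
    _ ≤ 1 / √(y * z) * (profile R (z + x - y) + profile R (z + y - x) - 2 * 0) := by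
      gcongr
      linarith

/-! ### Pointwise bounds on the quadratic integrand -/

/-- The integral over the outgoing energy in the quadratic collision term. -/
noncomputable def outgoingIntegral (φ : ℝ → ℝ) (a b : ℝ) : ℝ :=
  ∫ c in Set.Ioi (0 : ℝ), kernel a b c * √c * Q φ a b c

theorem outgoingIntegral_eq (φ : ℝ → ℝ) (a b : ℝ) : outgoingIntegral φ a b =
    ∫ c in Set.Ioo (0 : ℝ) (a + b), kernel a b c * √c * Q φ a b c := by
  refine setIntegral_eq_of_subset_of_forall_sdiff_eq_zero measurableSet_Ioi
    (fun c hc => hc.1) fun c hc => ?_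
  rw [kernel_eq_zero (not_lt.1 fun h => hc.2 ⟨hc.1, h⟩), zero_mul, zero_mul]

theorem kernel_mul_sqrt_mul_sqrt_max {a b c : ℝ} (ha : 0 ≤ a) (hb : 0 ≤ b) (hc : 0 ≤ c) :
    kernel a b c * √c * √(max a b) ≤ 1 := by
  rw [mul_assoc, ← Real.sqrt_mul hc]
  rcases max_choice a b with h | h <;> rw [h, mul_comm c]
  · exact kernel_mul_sqrt_mul_outer ha hb hc
  · exact kernel_mul_sqrt_mul_right ha hb hc

theorem add_le_two_mul_sqrt_max_mul {a b : ℝ} (ha : 0 ≤ a) :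
    a + b ≤ 2 * √(max a b) * √(max a b) := by
  rw [mul_assoc, Real.mul_self_sqrt (ha.trans (le_max_left a b))]
  have := le_max_left a b
  have := le_max_right a b
  linarith

theorem abs_outgoingIntegral_le {φ : ℝ → ℝ} {a b q : ℝ} (ha : 0 ≤ a) (hb : 0 ≤ b)
    (hq : 0 ≤ q) (h : ∀ c ∈ Set.Ioo 0 (a + b), |Q φ a b c| ≤ q) :
    |outgoingIntegral φ a b| ≤ 2 * √(max a b) * q := by
  rw [outgoingIntegral_eq]
  rcases (le_max_of_le_left ha : 0 ≤ max a b).eq_or_lt with h0 | h0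
  · have h1 := le_max_left a b
    have h2 := le_max_right a b
    rw [Set.Ioo_eq_empty (by linarith)]
    simp [← h0]
  have hs := Real.sqrt_pos.2 h0
  have hbd : ∀ c ∈ Set.Ioo 0 (a + b), ‖kernel a b c * √c * Q φ a b c‖ ≤ q / √(max a b) := by
    intro c hc
    have hk := kernel_nonneg a b c
    rw [norm_mul, Real.norm_eq_abs, Real.norm_eq_abs, abs_of_nonneg (by positivity),
      le_div_iff₀ hs]
    calc _ = (kernel a b c * √c * √(max a b)) * |Q φ a b c| := by ring
      _ ≤ 1 * q := mul_le_mul (kernel_mul_sqrt_mul_sqrt_max ha hb hc.1.le) (h c hc)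
          (abs_nonneg _) zero_le_one
      _ = q := one_mul q
  have := norm_setIntegral_le_of_norm_le_const (μ := volume) (by simp) hbd
  rw [Real.norm_eq_abs, Real.volume_real_Ioo_of_le (by linarith)] at this
  refine this.trans ?_
  rw [div_mul_eq_mul_div, div_le_iff₀ hs, sub_zero]
  have := mul_le_mul_of_nonneg_left (add_le_two_mul_sqrt_max_mul (b := b) ha) hq
  linarith

theorem neg_le_outgoingIntegral {R a b : ℝ} (ha : 0 ≤ a) (hb : 0 ≤ b) :
    -(2 * √(max a b) * (profile R a + profile R b)) ≤ outgoingIntegral (profile R) a b := by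
  rw [outgoingIntegral_eq]
  have hpa := profile_nonneg R a
  have hpb := profile_nonneg R b
  by_cases hi : IntegrableOn (fun c => kernel a b c * √c * Q (profile R) a b c)
    (Set.Ioo (0 : ℝ) (a + b))
  swap
  -- the integral of a non-integrable function is zero, which satisfies the bound
  · rw [integral_undef hi]
    simp only [Left.neg_nonpos_iff]
    positivity
  rcases (le_max_of_le_left ha : 0 ≤ max a b).eq_or_lt with h0 | h0
  · have h1 := le_max_left a b
    have h2 := le_max_right a b
    rw [Set.Ioo_eq_empty (by linarith)]
    simp [← h0]
  have hs := Real.sqrt_pos.2 h0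
  have hbd : ∀ c ∈ Set.Ioo 0 (a + b), -((profile R a + profile R b) / √(max a b)) ≤
      kernel a b c * √c * Q (profile R) a b c := by
    intro c hc
    have hk := kernel_nonneg a b c
    have hQ : -(profile R a + profile R b) ≤ Q (profile R) a b c := by
      have := profile_nonneg R c
      have := profile_nonneg R (a + b - c)
      unfold Q; linarith
    have h1 : kernel a b c * √c ≤ 1 / √(max a b) := by
      rw [le_div_iff₀ hs]; exact kernel_mul_sqrt_mul_sqrt_max ha hb hc.1.le
    have h2 : 0 ≤ kernel a b c * √c := by positivity
    calc -((profile R a + profile R b) / √(max a b))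
        = -(1 / √(max a b) * (profile R a + profile R b)) := by ring
      _ ≤ -(kernel a b c * √c * (profile R a + profile R b)) := by gcongr
      _ = kernel a b c * √c * -(profile R a + profile R b) := by ring
      _ ≤ _ := by gcongr
  have := setIntegral_mono_on (μ := volume) (integrableOn_const (by simp)) hi measurableSet_Ioo hbd
  rw [setIntegral_const, Real.volume_real_Ioo_of_le (by linarith), smul_eq_mul] at this
  refine le_trans ?_ this
  rw [sub_zero, mul_neg, neg_le_neg_iff, mul_div_assoc', div_le_iff₀ hs]
  have := mul_le_mul_of_nonneg_right (add_le_two_mul_sqrt_max_mul (b := b) ha)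
    (add_nonneg hpa hpb)
  linarith

theorem abs_Q_profile_le_max {R a b c : ℝ} (hR : 0 < R) (ha : 0 ≤ a) (hb : 0 ≤ b)
    (hc : c ∈ Set.Ioo 0 (a + b)) : |Q (profile R) a b c| ≤ 6 / R * max a b := by
  have h1 := abs_profile_sub_le hR hc.1.le ha
  have h2 := abs_profile_sub_le hR (by linarith [hc.2] : 0 ≤ a + b - c) hb
  have h3 : |c - a| ≤ max a b := by
    have h1 := le_max_left a b
    have h2 := le_max_right a b
    rw [abs_le]; constructor <;> linarith [hc.1, hc.2]
  rw [show a + b - c - b = -(c - a) by ring, abs_neg] at h2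
  calc |Q (profile R) a b c|
      = |(profile R c - profile R a) + (profile R (a + b - c) - profile R b)| := by
        unfold Q; congr 1; ring
    _ ≤ 3 / R * |c - a| + 3 / R * |c - a| := (abs_add_le _ _).trans (add_le_add h1 h2)
    _ ≤ 3 / R * max a b + 3 / R * max a b := by gcongr
    _ = _ := by ring

/-- Interpolating between `|Q| ≤ 2` and the Lipschitz bound shows that the quadratic integrand
grows at most linearly, with a constant vanishing as `R → ∞`. -/
theorem abs_outgoingIntegral_profile_le {R a b : ℝ} (hR : 0 < R) (ha : 0 ≤ a) (hb : 0 ≤ b) :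
    |outgoingIntegral (profile R) a b| ≤ 8 / √R * (a + b) := by
  have hm : 0 ≤ max a b := le_max_of_le_left ha
  have hm' : max a b ≤ a + b := max_le (by linarith) (by linarith)
  refine (abs_outgoingIntegral_le (q := 4 * √(max a b / R)) ha hb (by positivity) ?_).trans ?_
  · intro c hc
    refine abs_le_of_sq_le_sq (b := 4 * √(max a b / R)) ?_ (by positivity)
    rw [mul_pow, Real.sq_sqrt (by positivity), ← sq_abs, sq]
    calc _ ≤ 2 * (6 / R * max a b) :=
          mul_le_mul (abs_Q_profile_le_two hR ha hb hc.1.le hc.2.le)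
            (abs_Q_profile_le_max hR ha hb hc) (abs_nonneg _) zero_le_two
      _ = 12 * (max a b / R) := by ring
      _ ≤ 4 ^ 2 * (max a b / R) := by gcongr; norm_num
  · rw [Real.sqrt_div hm]
    calc 2 * √(max a b) * (4 * (√(max a b) / √R))
        = 8 / √R * (√(max a b) * √(max a b)) := by ring
      _ = 8 / √R * max a b := by rw [Real.mul_self_sqrt hm]
      _ ≤ _ := by gcongr

/-! ### Measurability -/

theorem measurable_kernel :
    Measurable fun p : ℝ × ℝ × ℝ => kernel p.1 p.2.1 p.2.2 := by
  unfold kernel Phi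
  refine Measurable.ite ?_ (by fun_prop) (Measurable.ite ?_ (by fun_prop) measurable_const)
  · have h1 : Measurable fun p : ℝ × ℝ × ℝ => p.1 := by fun_prop
    have h2 : Measurable fun p : ℝ × ℝ × ℝ => p.2.1 := by fun_prop
    have h3 : Measurable fun p : ℝ × ℝ × ℝ => p.2.2 := by fun_prop
    exact (measurableSet_lt measurable_const h1).inter
      ((measurableSet_lt measurable_const h2).inter (measurableSet_lt measurable_const h3))
  · exact measurableSet_lt (by fun_prop) (by fun_prop)

theorem measurable_Q_profile (R : ℝ) :
    Measurable fun p : ℝ × ℝ × ℝ => Q (profile R) p.1 p.2.1 p.2.2 := by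
  have := (continuous_profile R).measurable
  unfold Q
  fun_prop

theorem measurable_outgoingIntegral_profile (R : ℝ) :
    Measurable fun p : ℝ × ℝ => outgoingIntegral (profile R) p.1 p.2 := by
  have h : Measurable fun q : (ℝ × ℝ) × ℝ =>
      kernel q.1.1 q.1.2 q.2 * √q.2 * Q (profile R) q.1.1 q.1.2 q.2 := by
    have e : Measurable fun q : (ℝ × ℝ) × ℝ => (q.1.1, q.1.2, q.2) := by fun_prop
    have h1 : Measurable fun q : (ℝ × ℝ) × ℝ => kernel q.1.1 q.1.2 q.2 := measurable_kernel.comp e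
    have h2 : Measurable fun q : (ℝ × ℝ) × ℝ => Q (profile R) q.1.1 q.1.2 q.2 := by
      have := (continuous_profile R).measurable
      unfold Q
      fun_prop
    have h3 : Measurable fun q : (ℝ × ℝ) × ℝ => √q.2 := by fun_prop
    exact (h1.mul h3).mul h2
  exact (h.stronglyMeasurable.integral_prod_right'
    (ν := volume.restrict (Set.Ioi (0 : ℝ)))).measurable

/-! ### The collision terms of a fixed measure -/

section FixedMeasure

variable {μ : Measure ℝ≥0} [IsFiniteMeasure μ]

/-- The integrand of the cubic collision term, for the profile. -/
noncomputable def cubicIntegrand (R : ℝ) (p : ℝ≥0 × ℝ≥0 × ℝ≥0) : ℝ :=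
  kernel p.1 p.2.1 p.2.2 * Q (profile R) p.1 p.2.1 p.2.2

theorem measurable_cubicIntegrand (R : ℝ) : Measurable (cubicIntegrand R) := by
  have e : Measurable fun p : ℝ≥0 × ℝ≥0 × ℝ≥0 => ((p.1 : ℝ), (p.2.1 : ℝ), (p.2.2 : ℝ)) := by
    fun_prop
  exact (measurable_kernel.mul (measurable_Q_profile R)).comp e

theorem abs_cubicIntegrand_le {R : ℝ} (hR : 0 < R) (p : ℝ≥0 × ℝ≥0 × ℝ≥0) :
    |cubicIntegrand R p| ≤ 4 / R :=
  abs_kernel_mul_Q_profile_le hR p.1.2 p.2.1.2 p.2.2.2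

theorem integrable_cubicIntegrand {R : ℝ} (hR : 0 < R) {α : Type*} [MeasurableSpace α]
    {ν : Measure α} [IsFiniteMeasure ν] {e : α → ℝ≥0 × ℝ≥0 × ℝ≥0} (he : Measurable e) :
    Integrable (fun x => cubicIntegrand R (e x)) ν :=
  Integrable.of_bound ((measurable_cubicIntegrand R).comp he).aestronglyMeasurable (4 / R)
    (Filter.Eventually.of_forall fun x => abs_cubicIntegrand_le hR (e x))

theorem cubicTerm_eq {R : ℝ} (hR : 0 < R) : cubicTerm μ (profile R) =
    1 / (2 : ℝ) ^ (5 / 2 : ℝ) * ∫ p, cubicIntegrand R p ∂(μ.prod (μ.prod μ)) := by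
  rw [integral_prod (cubicIntegrand R)
    (integrable_cubicIntegrand (e := fun p => p) hR measurable_id)]
  unfold cubicTerm
  congr 1
  refine integral_congr_ae (Filter.Eventually.of_forall fun x => ?_)
  have := integral_prod (μ := μ) (ν := μ) (fun q : ℝ≥0 × ℝ≥0 => cubicIntegrand R (x, q))
    (integrable_cubicIntegrand hR (by fun_prop))
  exact this.symm

theorem integral_rotate (f : ℝ≥0 × ℝ≥0 × ℝ≥0 → ℝ) :
    ∫ p, f (p.2.1, p.2.2, p.1) ∂(μ.prod (μ.prod μ)) = ∫ p, f p ∂(μ.prod (μ.prod μ)) := by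
  have h1 : MeasurePreserving (MeasurableEquiv.prodComm : ℝ≥0 × (ℝ≥0 × ℝ≥0) ≃ᵐ _)
      (μ.prod (μ.prod μ)) ((μ.prod μ).prod μ) := Measure.measurePreserving_swap
  have h2 := (measurePreserving_prodAssoc μ μ μ).comp h1
  exact (h2.integral_comp ((MeasurableEquiv.prodAssoc).measurableEmbedding.comp
    (MeasurableEquiv.prodComm).measurableEmbedding) f)

theorem three_mul_integral_cubicIntegrand {R : ℝ} (hR : 0 < R) :
    3 * ∫ p, cubicIntegrand R p ∂(μ.prod (μ.prod μ)) =
      ∫ p, cyclicSum (profile R) p.1 p.2.1 p.2.2 ∂(μ.prod (μ.prod μ)) := by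
  have h1 := integral_rotate (μ := μ) (cubicIntegrand R)
  have h2 := integral_rotate (μ := μ) (fun p => cubicIntegrand R (p.2.1, p.2.2, p.1))
  have i1 : Integrable (fun p => cubicIntegrand R p) (μ.prod (μ.prod μ)) :=
    integrable_cubicIntegrand hR measurable_id
  have i2 : Integrable (fun p => cubicIntegrand R (p.2.1, p.2.2, p.1)) (μ.prod (μ.prod μ)) :=
    integrable_cubicIntegrand hR (by fun_prop)
  have i3 : Integrable (fun p => cubicIntegrand R (p.2.2, p.1, p.2.1)) (μ.prod (μ.prod μ)) :=
    integrable_cubicIntegrand hR (by fun_prop)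
  have e : ∀ p : ℝ≥0 × ℝ≥0 × ℝ≥0, cyclicSum (profile R) p.1 p.2.1 p.2.2 =
      cubicIntegrand R p + cubicIntegrand R (p.2.1, p.2.2, p.1) +
        cubicIntegrand R (p.2.2, p.1, p.2.1) := fun p => rfl
  simp only at h2
  simp_rw [e]
  have i12 : Integrable (fun p => cubicIntegrand R p + cubicIntegrand R (p.2.1, p.2.2, p.1))
      (μ.prod (μ.prod μ)) := i1.add i2
  rw [integral_add i12 i3, integral_add i1 i2, h2, h1]
  ring

theorem integrable_cyclicSum {R : ℝ} (hR : 0 < R) :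
    Integrable (fun p : ℝ≥0 × ℝ≥0 × ℝ≥0 => cyclicSum (profile R) p.1 p.2.1 p.2.2)
      (μ.prod (μ.prod μ)) := by
  have i1 : Integrable (fun p => cubicIntegrand R p) (μ.prod (μ.prod μ)) :=
    integrable_cubicIntegrand hR measurable_id
  have i2 : Integrable (fun p => cubicIntegrand R (p.2.1, p.2.2, p.1)) (μ.prod (μ.prod μ)) :=
    integrable_cubicIntegrand hR (by fun_prop)
  have i3 : Integrable (fun p => cubicIntegrand R (p.2.2, p.1, p.2.1)) (μ.prod (μ.prod μ)) :=
    integrable_cubicIntegrand hR (by fun_prop)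
  exact (i1.add i2).add i3

/-- The positive constant in the lower bounds for the cubic term: the prefactor `2^(-5/2)`, the
average over three rotations, and the value `1 / 64` of the profile at `3 R / 4`. -/
noncomputable def cubicConst : ℝ := 1 / (2 : ℝ) ^ (5 / 2 : ℝ) / 192

theorem cubicConst_pos : 0 < cubicConst := by unfold cubicConst; positivity

theorem cubicTerm_profile_nonneg {R : ℝ} (hR : 0 < R) : 0 ≤ cubicTerm μ (profile R) := by
  rw [cubicTerm_eq hR]
  have h := three_mul_integral_cubicIntegrand (μ := μ) hR
  have h0 : 0 ≤ ∫ p, cyclicSum (profile R) p.1 p.2.1 p.2.2 ∂(μ.prod (μ.prod μ)) :=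
    integral_nonneg fun p => cyclicSum_nonneg (convexOn_profile hR) p.1.2 p.2.1.2 p.2.2.2
  exact mul_nonneg (by positivity) (by linarith)

theorem le_cubicTerm_profile_of_set {R ρ : ℝ} (hR : 0 < R) (hRρ : R ≤ ρ) {I : Set ℝ≥0}
    (hI : MeasurableSet I) (hIR : ∀ y ∈ I, R ≤ (y : ℝ) ∧ (y : ℝ) ≤ ρ)
    (hII : ∀ y ∈ I, ∀ z ∈ I, |(y : ℝ) - z| ≤ R / 4) :
    cubicConst / ρ * μ.real {x | (x : ℝ) ≤ R / 2} * μ.real I ^ 2 ≤ cubicTerm μ (profile R) := by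
  rw [cubicTerm_eq hR]
  have h := three_mul_integral_cubicIntegrand (μ := μ) hR
  have hA : MeasurableSet {x : ℝ≥0 | (x : ℝ) ≤ R / 2} :=
    measurableSet_le (by fun_prop) measurable_const
  set B : Set (ℝ≥0 × ℝ≥0 × ℝ≥0) := {x : ℝ≥0 | (x : ℝ) ≤ R / 2} ×ˢ (I ×ˢ I) with hB
  have hBm : MeasurableSet B := hA.prod (hI.prod hI)
  have h1 : ∫ p in B, cyclicSum (profile R) p.1 p.2.1 p.2.2 ∂(μ.prod (μ.prod μ)) ≤
      ∫ p, cyclicSum (profile R) p.1 p.2.1 p.2.2 ∂(μ.prod (μ.prod μ)) :=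
    setIntegral_le_integral (integrable_cyclicSum hR) (Filter.Eventually.of_forall fun p =>
      cyclicSum_nonneg (convexOn_profile hR) p.1.2 p.2.1.2 p.2.2.2)
  have h2 : ∫ _ in B, 1 / (64 * ρ) ∂(μ.prod (μ.prod μ)) ≤
      ∫ p in B, cyclicSum (profile R) p.1 p.2.1 p.2.2 ∂(μ.prod (μ.prod μ)) := by
    refine setIntegral_mono_on (integrableOn_const (by finiteness))
      (integrable_cyclicSum hR).integrableOn hBm ?_
    rintro ⟨x, y, z⟩ ⟨hx, hy, hz⟩
    exact le_cyclicSum_profile hR x.2 hx (hIR y hy).1 (hIR y hy).2 (hIR z hz).1 (hIR z hz).2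
      (hII y hy z hz)
  rw [setIntegral_const, hB, measureReal_prod_prod, measureReal_prod_prod, smul_eq_mul] at h2
  have h3 := h2.trans h1
  rw [← h] at h3
  have h4 : (0 : ℝ) < 1 / (2 : ℝ) ^ (5 / 2 : ℝ) := by positivity
  have h5 := mul_le_mul_of_nonneg_left h3 h4.le
  have hρ : ρ ≠ 0 := (hR.trans_le hRρ).ne'
  unfold cubicConst
  generalize 1 / (2 : ℝ) ^ (5 / 2 : ℝ) = k at *
  generalize μ.real {x | (x : ℝ) ≤ R / 2} = u at *
  generalize μ.real I = v at *
  have e : k / 192 / ρ * u * v ^ 2 = k * (u * (v * v) * (1 / (64 * ρ))) / 3 := by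
    field_simp
    ring
  rw [e]
  linarith

/-- Some interval of length `R / 4` carries at least the fraction `R / (5 ρ)` of the mass in
`(R, ρ]`. -/
theorem exists_short_interval {R ρ : ℝ} (hR : 0 < R) (hRρ : R ≤ ρ) :
    ∃ I : Set ℝ≥0, MeasurableSet I ∧ (∀ y ∈ I, R ≤ (y : ℝ) ∧ (y : ℝ) ≤ ρ) ∧
      (∀ y ∈ I, ∀ z ∈ I, |(y : ℝ) - z| ≤ R / 4) ∧
      μ.real {y | R < (y : ℝ) ∧ (y : ℝ) ≤ ρ} * (R / (5 * ρ)) ≤ μ.real I := by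
  have hρ : 0 < ρ := hR.trans_le hRρ
  set n : ℕ := ⌈4 * ρ / R⌉₊ with hn
  have hn0 : 0 < n := Nat.ceil_pos.2 (by positivity)
  have hnle : (n : ℝ) ≤ 5 * ρ / R := by
    have h1 := (Nat.ceil_lt_add_one (by positivity : 0 ≤ 4 * ρ / R)).le
    have h2 : 1 ≤ ρ / R := by rwa [one_le_div hR]
    calc (n : ℝ) ≤ 4 * ρ / R + 1 := h1
      _ ≤ 4 * ρ / R + ρ / R := by linarith
      _ = 5 * ρ / R := by ring
  let I : ℕ → Set ℝ≥0 := fun j =>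
    {y | R + j * (R / 4) ≤ (y : ℝ) ∧ (y : ℝ) ≤ R + (j + 1) * (R / 4) ∧ (y : ℝ) ≤ ρ}
  have hcoe : Measurable fun y : ℝ≥0 => (y : ℝ) := measurable_coe_nnreal_real
  have hIm : ∀ j, MeasurableSet (I j) := fun j =>
    (measurableSet_le measurable_const hcoe).inter
      ((measurableSet_le hcoe measurable_const).inter (measurableSet_le hcoe measurable_const))
  have hcover : {y : ℝ≥0 | R < (y : ℝ) ∧ (y : ℝ) ≤ ρ} ⊆ ⋃ j ∈ Finset.range n, I j := by
    rintro y ⟨hy1, hy2⟩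
    have hq : 0 ≤ ((y : ℝ) - R) / (R / 4) := div_nonneg (by linarith) (by linarith)
    simp only [Set.mem_iUnion, Finset.mem_range]
    have hlo := (le_div_iff₀ (by positivity : 0 < R / 4)).1 (Nat.floor_le hq)
    have hhi := (div_lt_iff₀ (by positivity : 0 < R / 4)).1 (Nat.lt_floor_add_one
      (((y : ℝ) - R) / (R / 4)))
    refine ⟨⌊((y : ℝ) - R) / (R / 4)⌋₊, ?_, by linarith, by linarith, hy2⟩
    have h1 : ((⌊((y : ℝ) - R) / (R / 4)⌋₊ : ℕ) : ℝ) < 4 * ρ / R := by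
      refine (Nat.floor_le hq).trans_lt ?_
      rw [div_lt_div_iff₀ (by positivity) hR]
      nlinarith
    exact_mod_cast h1.trans_le (Nat.le_ceil _)
  have hsum : μ.real {y : ℝ≥0 | R < (y : ℝ) ∧ (y : ℝ) ≤ ρ} ≤
      ∑ j ∈ Finset.range n, μ.real (I j) :=
    (measureReal_mono hcover (measure_ne_top μ _)).trans (measureReal_biUnion_finset_le _ _)
  obtain ⟨j, -, hj⟩ : ∃ j ∈ Finset.range n,
      μ.real {y : ℝ≥0 | R < (y : ℝ) ∧ (y : ℝ) ≤ ρ} / n ≤ μ.real (I j) := by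
    refine Finset.exists_le_of_sum_le (Finset.nonempty_range_iff.2 hn0.ne') ?_
    rw [Finset.sum_const, Finset.card_range, nsmul_eq_mul, mul_div_cancel₀]
    · exact hsum
    · exact_mod_cast hn0.ne'
  refine ⟨I j, hIm j, fun y hy => ⟨?_, hy.2.2⟩, fun y hy z hz => ?_, le_trans ?_ hj⟩
  · have : 0 ≤ (j : ℝ) * (R / 4) := by positivity
    linarith [hy.1]
  · rw [abs_le]
    constructor <;> nlinarith [hy.1, hy.2.1, hz.1, hz.2.1]
  · rw [div_eq_mul_inv _ (n : ℝ), ← inv_div]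
    refine mul_le_mul_of_nonneg_left ?_ measureReal_nonneg
    exact inv_anti₀ (by exact_mod_cast hn0) hnle

/-- Mass in `(R, ρ]` makes the mass near zero grow at a rate proportional to itself. -/
theorem le_cubicTerm_profile {R ρ d : ℝ} (hR : 0 < R) (hRρ : R ≤ ρ) (hd : 0 ≤ d)
    (h : d ≤ μ.real {y | R < (y : ℝ) ∧ (y : ℝ) ≤ ρ}) :
    cubicConst / 25 * (R ^ 2 * d ^ 2 / ρ ^ 3) * μ.real {x | (x : ℝ) ≤ R / 2} ≤
      cubicTerm μ (profile R) := by
  obtain ⟨I, hI, h1, h2, h3⟩ := exists_short_interval (μ := μ) hR hRρ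
  have hρ : 0 < ρ := hR.trans_le hRρ
  refine le_trans ?_ (le_cubicTerm_profile_of_set hR hRρ hI h1 h2)
  have h4 : d * (R / (5 * ρ)) ≤ μ.real I := (by gcongr : _ ≤ _).trans h3
  have h5 := cubicConst_pos
  calc _ = cubicConst / ρ * μ.real {x | (x : ℝ) ≤ R / 2} * (d * (R / (5 * ρ))) ^ 2 := by
        generalize μ.real {x | (x : ℝ) ≤ R / 2} = u
        field_simp
        ring
    _ ≤ _ := by gcongr

theorem abs_cubicTerm_profile_le {R : ℝ} (hR : 0 < R) :
    |cubicTerm μ (profile R)| ≤ 4 / R * μ.real Set.univ ^ 3 := by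
  rw [cubicTerm_eq hR, abs_mul]
  have h1 : |1 / (2 : ℝ) ^ (5 / 2 : ℝ)| ≤ 1 := by
    rw [abs_of_pos (by positivity), div_le_one (by positivity)]
    exact Real.one_le_rpow (by norm_num) (by norm_num)
  have h2 := norm_integral_le_of_norm_le_const (μ := μ.prod (μ.prod μ)) (f := cubicIntegrand R)
    (C := 4 / R) (Filter.Eventually.of_forall (abs_cubicIntegrand_le hR))
  rw [← Set.univ_prod_univ, measureReal_prod_prod, ← Set.univ_prod_univ,
    measureReal_prod_prod, Real.norm_eq_abs] at h2
  calc _ ≤ 1 * (4 / R * (μ.real Set.univ * (μ.real Set.univ * μ.real Set.univ))) :=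
        mul_le_mul h1 h2 (abs_nonneg _) zero_le_one
    _ = _ := by ring

theorem integrable_profile {R : ℝ} (hR : 0 < R) : Integrable (fun ε : ℝ≥0 => profile R ε) μ := by
  refine Integrable.of_bound (((continuous_profile R).measurable.comp
    measurable_coe_nnreal_real).aestronglyMeasurable) 1 (Filter.Eventually.of_forall fun x => ?_)
  rw [Real.norm_eq_abs, abs_of_nonneg (profile_nonneg _ _)]
  exact profile_le_one hR x.2

theorem measurable_outgoing (R : ℝ) :
    Measurable fun p : ℝ≥0 × ℝ≥0 => outgoingIntegral (profile R) p.1 p.2 := by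
  have e : Measurable fun p : ℝ≥0 × ℝ≥0 => ((p.1 : ℝ), (p.2 : ℝ)) := by fun_prop
  exact (measurable_outgoingIntegral_profile R).comp e

theorem integrable_outgoing {R : ℝ} (hR : 0 < R) (he : Integrable (fun ε : ℝ≥0 => (ε : ℝ)) μ) :
    Integrable (fun p : ℝ≥0 × ℝ≥0 => outgoingIntegral (profile R) p.1 p.2) (μ.prod μ) :=
  (((he.comp_fst μ).add (he.comp_snd μ)).const_mul (8 / √R)).mono'
    (measurable_outgoing R).aestronglyMeasurable
    (Filter.Eventually.of_forall fun p => abs_outgoingIntegral_profile_le hR p.1.2 p.2.2)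

theorem quadraticTerm_eq {R : ℝ} (hR : 0 < R) (he : Integrable (fun ε : ℝ≥0 => (ε : ℝ)) μ) :
    quadraticTerm μ (profile R) =
      Real.pi / 2 * ∫ p, outgoingIntegral (profile R) (p.1 : ℝ≥0) (p.2 : ℝ≥0) ∂(μ.prod μ) := by
  rw [integral_prod _ (integrable_outgoing hR he)]
  rfl

theorem abs_quadraticTerm_profile_le {R : ℝ} (hR : 0 < R)
    (he : Integrable (fun ε : ℝ≥0 => (ε : ℝ)) μ) :
    |quadraticTerm μ (profile R)| ≤
      8 * Real.pi / √R * (μ.real Set.univ * ∫ ε, (ε : ℝ) ∂μ) := by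
  have h1 : |∫ p, outgoingIntegral (profile R) (p.1 : ℝ≥0) (p.2 : ℝ≥0) ∂(μ.prod μ)| ≤
      ∫ p, 8 / √R * ((p.1 : ℝ≥0) + (p.2 : ℝ≥0) : ℝ) ∂(μ.prod μ) := by
    have hi : Integrable (fun p : ℝ≥0 × ℝ≥0 => 8 / √R * ((p.1 : ℝ) + (p.2 : ℝ))) (μ.prod μ) :=
      ((he.comp_fst μ).add (he.comp_snd μ)).const_mul (8 / √R)
    exact norm_integral_le_of_norm_le
      (f := fun p : ℝ≥0 × ℝ≥0 => outgoingIntegral (profile R) p.1 p.2) hi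
      (Filter.Eventually.of_forall fun p => abs_outgoingIntegral_profile_le hR p.1.2 p.2.2)
  rw [integral_const_mul, integral_add (he.comp_fst μ) (he.comp_snd μ),
    integral_fun_fst (fun ε : ℝ≥0 => (ε : ℝ)), integral_fun_snd (fun ε : ℝ≥0 => (ε : ℝ)),
    smul_eq_mul] at h1
  rw [quadraticTerm_eq hR he, abs_mul, abs_of_pos (by positivity)]
  calc _ ≤ Real.pi / 2 * (8 / √R * (μ.real Set.univ * ∫ ε, (ε : ℝ) ∂μ +
        μ.real Set.univ * ∫ ε, (ε : ℝ) ∂μ)) := by gcongr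
    _ = _ := by ring

/-- At scales `R ≤ 1` the quadratic term removes mass near zero at most at a rate proportional to
that mass, with a constant depending on mass and energy only. -/
theorem neg_le_quadraticTerm_profile {R : ℝ} (hR : 0 < R) (hR1 : R ≤ 1)
    (he : Integrable (fun ε : ℝ≥0 => (ε : ℝ)) μ) :
    -(2 * Real.pi * (2 * μ.real Set.univ + ∫ ε, (ε : ℝ) ∂μ) * ∫ ε, profile R (ε : ℝ≥0) ∂μ) ≤
      quadraticTerm μ (profile R) := by
  have hp := integrable_profile (μ := μ) hR
  have he2 : Integrable (fun ε : ℝ≥0 => 2 + (ε : ℝ)) μ := (integrable_const 2).add he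
  have hint1 := hp.mul_prod he2
  have hint2 := he2.mul_prod hp
  have aux : ∀ a b : ℝ≥0, √(max (a : ℝ) b) * profile R a ≤ profile R a * (2 + b) := by
    intro a b
    have hb : (0 : ℝ) ≤ b := b.2
    rcases le_total R (a : ℝ) with h | h
    · rw [profile_eq_zero hR h]; simp
    · have h2 : √(max (a : ℝ) b) ≤ 2 + b := by
        rw [Real.sqrt_le_left (by positivity)]
        exact max_le (by nlinarith) (by nlinarith)
      rw [mul_comm]
      exact mul_le_mul_of_nonneg_left h2 (profile_nonneg _ _)
  have h1 : ∫ p, -(2 * (profile R (p.1 : ℝ≥0) * (2 + (p.2 : ℝ≥0)) +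
      (2 + (p.1 : ℝ≥0)) * profile R (p.2 : ℝ≥0))) ∂(μ.prod μ) ≤
      ∫ p, outgoingIntegral (profile R) (p.1 : ℝ≥0) (p.2 : ℝ≥0) ∂(μ.prod μ) := by
    refine integral_mono ((hint1.add hint2).const_mul 2).neg (integrable_outgoing hR he)
      fun p => ?_
    refine le_trans ?_ (neg_le_outgoingIntegral p.1.2 p.2.2)
    have h1 := aux p.1 p.2
    have h2 := aux p.2 p.1
    rw [max_comm] at h2
    simp only
    linarith
  rw [integral_neg, integral_const_mul, integral_add hint1 hint2,
    integral_prod_mul (fun ε : ℝ≥0 => profile R ε) (fun ε : ℝ≥0 => 2 + (ε : ℝ)),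
    integral_prod_mul (fun ε : ℝ≥0 => 2 + (ε : ℝ)) (fun ε : ℝ≥0 => profile R ε),
    integral_add (integrable_const 2) he, integral_const, smul_eq_mul] at h1
  rw [quadraticTerm_eq hR he]
  have := mul_le_mul_of_nonneg_left h1 (by positivity : 0 ≤ Real.pi / 2)
  linarith

theorem integral_profile_le {R : ℝ} (hR : 0 < R) :
    ∫ ε, profile R (ε : ℝ≥0) ∂μ ≤ μ.real {x | (x : ℝ) ≤ R} := by
  have hA : MeasurableSet {x : ℝ≥0 | (x : ℝ) ≤ R} :=
    measurableSet_le (by fun_prop) measurable_const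
  rw [← integral_indicator_one hA]
  refine integral_mono (integrable_profile hR) ((integrable_const 1).indicator hA) fun x => ?_
  by_cases hx : (x : ℝ) ≤ R
  · simpa [Set.indicator, hx] using profile_le_one hR x.2
  · simp [Set.indicator, hx, profile_eq_zero hR (not_le.1 hx).le]

theorem le_integral_profile {r R : ℝ} (hR : 0 < R) (hr : r ≤ R) :
    (1 - r / R) ^ 3 * μ.real {x | (x : ℝ) ≤ r} ≤ ∫ ε, profile R (ε : ℝ≥0) ∂μ := by
  have hA : MeasurableSet {x : ℝ≥0 | (x : ℝ) ≤ r} :=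
    measurableSet_le (by fun_prop) measurable_const
  rw [mul_comm, ← smul_eq_mul, ← integral_indicator_const _ hA]
  refine integral_mono ((integrable_const _).indicator hA) (integrable_profile hR) fun x => ?_
  by_cases hx : (x : ℝ) ≤ r
  · simpa [Set.indicator, hx] using le_profile r hR hr hx
  · simpa [Set.indicator, hx] using profile_nonneg R x

end FixedMeasure

/-! ### Moments and measurability in time -/

theorem isFiniteMeasure_of_lintegral_le {μ : Measure ℝ≥0} {C : ℝ≥0}
    (h : ∫⁻ ε, (1 + (ε : ℝ≥0∞)) ∂μ ≤ C) : IsFiniteMeasure μ := by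
  refine ⟨lt_of_le_of_lt ?_ (h.trans_lt ENNReal.coe_lt_top)⟩
  rw [← lintegral_one]
  exact lintegral_mono fun x => le_self_add

theorem measureReal_univ_le {μ : Measure ℝ≥0} {C : ℝ≥0}
    (h : ∫⁻ ε, (1 + (ε : ℝ≥0∞)) ∂μ ≤ C) : μ.real Set.univ ≤ C := by
  have h1 : μ Set.univ ≤ C := by
    refine le_trans ?_ h
    rw [← lintegral_one]
    exact lintegral_mono fun x => le_self_add
  exact ENNReal.toReal_mono ENNReal.coe_ne_top h1

theorem integrable_energy {μ : Measure ℝ≥0} (h : ∫⁻ ε, (ε : ℝ≥0∞) ∂μ ≠ ∞) :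
    Integrable (fun ε : ℝ≥0 => (ε : ℝ)) μ := by
  refine ⟨measurable_coe_nnreal_real.aestronglyMeasurable, ?_⟩
  rw [hasFiniteIntegral_iff_enorm]
  simpa using h.lt_top

theorem lintegral_energy_le {μ : Measure ℝ≥0} {C : ℝ≥0}
    (h : ∫⁻ ε, (1 + (ε : ℝ≥0∞)) ∂μ ≤ C) : ∫⁻ ε, (ε : ℝ≥0∞) ∂μ ≤ C :=
  (lintegral_mono fun _ => le_add_self).trans h

theorem integral_energy_eq {μ : Measure ℝ≥0} :
    ∫ ε, (ε : ℝ) ∂μ = (∫⁻ ε, (ε : ℝ≥0∞) ∂μ).toReal := by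
  rw [integral_eq_lintegral_of_nonneg_ae (Filter.Eventually.of_forall fun ε => ε.2)
    measurable_coe_nnreal_real.aestronglyMeasurable]
  congr 1
  exact lintegral_congr fun ε => by simp

open Classical in
/-- The family `g` restricted to the time interval `[0, T']` and extended by the zero measure. -/
noncomputable def truncation (T' : ℝ) (g : ℝ → Measure ℝ≥0) (t : ℝ) : Measure ℝ≥0 :=
  if t ∈ Set.Icc 0 T' then g t else 0

theorem truncation_of_mem {T' t : ℝ} {g : ℝ → Measure ℝ≥0} (ht : t ∈ Set.Icc 0 T') :
    truncation T' g t = g t := if_pos ht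

section Solution

variable {T T' : ℝ} {g₀ : Measure ℝ≥0} {g : ℝ → Measure ℝ≥0}

theorem IsWeakSolution.isFiniteMeasure (hg : IsWeakSolution T g₀ g) {t : ℝ}
    (ht : t ∈ Set.Ico 0 T) : IsFiniteMeasure (g t) := by
  obtain ⟨C, hC⟩ := hg.locally_bounded t ht.2
  exact isFiniteMeasure_of_lintegral_le (hC t ⟨ht.1, le_rfl⟩)

theorem IsWeakSolution.integrable_energy (hg : IsWeakSolution T g₀ g) {t : ℝ}
    (ht : t ∈ Set.Ico 0 T) : Integrable (fun ε : ℝ≥0 => (ε : ℝ)) (g t) := by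
  obtain ⟨C, hC⟩ := hg.locally_bounded t ht.2
  exact Nordheim.integrable_energy (ne_top_of_le_ne_top ENNReal.coe_ne_top
    (lintegral_energy_le (hC t ⟨ht.1, le_rfl⟩)))

theorem IsWeakSolution.isFiniteMeasure_truncation (hg : IsWeakSolution T g₀ g) (hT' : T' < T)
    (t : ℝ) : IsFiniteMeasure (truncation T' g t) := by
  unfold truncation
  split_ifs with h
  · exact hg.isFiniteMeasure ⟨h.1, h.2.trans_lt hT'⟩
  · infer_instance

theorem hasCompactSupport_of_le {ψ : ℝ≥0 → ℝ} (r : ℝ≥0) (h : ∀ x, r < x → ψ x = 0) :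
    HasCompactSupport ψ := by
  refine HasCompactSupport.of_support_subset_isCompact (isCompact_Icc (a := 0) (b := r)) ?_
  intro x hx
  exact ⟨zero_le, not_lt.1 fun hlt => hx (h x hlt)⟩

theorem IsWeakSolution.measurable_integral_truncation (hg : IsWeakSolution T g₀ g)
    (hT' : T' < T) {ψ : ℝ≥0 → ℝ} (hψ : Continuous ψ) (hs : HasCompactSupport ψ) :
    Measurable fun t => ∫ ε, ψ ε ∂(truncation T' g t) := by
  classical
  have h1 : Measurable ((Set.Icc 0 T').piecewise (fun t => ∫ ε, ψ ε ∂(g t)) fun _ => 0) :=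
    ContinuousOn.measurable_piecewise
      ((hg.continuous ψ hψ hs).mono fun t ht => ⟨ht.1, ht.2.trans_lt hT'⟩)
      continuousOn_const measurableSet_Icc
  convert h1 using 2 with t
  unfold truncation Set.piecewise
  split_ifs <;> simp

/-- Weak-* continuity in time makes `t ↦ g t` a measurable family of measures. -/
theorem IsWeakSolution.measurable_truncation (hg : IsWeakSolution T g₀ g) (hT' : T' < T) :
    Measurable (truncation T' g) := by
  have hfin := hg.isFiniteMeasure_truncation hT'
  have hIic : ∀ x : ℝ≥0, Measurable fun t => truncation T' g t (Set.Iic x) := by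
    intro x
    have hδ : ∀ n : ℕ, (0 : ℝ) < 1 / ((n : ℝ) + 1) := fun n => by positivity
    have hlim : ∀ t, Filter.Tendsto
        (fun n : ℕ => ∫ ω, (thickenedIndicator (hδ n) (Set.Iic x) ω : ℝ) ∂(truncation T' g t))
        Filter.atTop (nhds ((truncation T' g t).real (Set.Iic x))) := fun t =>
      tendsto_integral_thickenedIndicator_of_isClosed _ isClosed_Iic hδ
        tendsto_one_div_add_atTop_nhds_zero_nat
    have hm : Measurable fun t => (truncation T' g t).real (Set.Iic x) := by
      refine measurable_of_tendsto_metrizable (fun n => ?_) (tendsto_pi_nhds.2 hlim)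
      refine hg.measurable_integral_truncation hT' ?_ (hasCompactSupport_of_le (x + 1) ?_)
      · exact NNReal.continuous_coe.comp (thickenedIndicator (hδ n) (Set.Iic x)).continuous
      · intro y hy
        rw [thickenedIndicator_zero, NNReal.coe_zero]
        rw [Metric.mem_thickening_iff]
        rintro ⟨z, hz, hyz⟩
        have h1 : (1 : ℝ) / ((n : ℝ) + 1) ≤ 1 := by
          rw [div_le_one (by positivity)]; linarith [(Nat.cast_nonneg n : (0 : ℝ) ≤ n)]
        rw [NNReal.dist_eq] at hyz
        have h2 : (z : ℝ) ≤ x := hz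
        have h3 : (x : ℝ) + 1 < y := by exact_mod_cast hy
        linarith [le_abs_self ((y : ℝ) - z)]
    have : (fun t => truncation T' g t (Set.Iic x)) =
        fun t => ENNReal.ofReal ((truncation T' g t).real (Set.Iic x)) := by
      ext t
      rw [ofReal_measureReal]
    rw [this]
    exact hm.ennreal_ofReal
  refine Measurable.measure_of_isPiSystem ?_ isPiSystem_Iic ?_ ?_
  · rw [← borel_eq_generateFrom_Iic]
    exact BorelSpace.measurable_eq
  · rintro s ⟨x, rfl⟩
    exact hIic x
  · have hlim : ∀ t, Filter.Tendsto (fun n : ℕ => truncation T' g t (Set.Iic (n : ℝ≥0)))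
        Filter.atTop (nhds (truncation T' g t Set.univ)) := by
      intro t
      have hmono : Monotone fun n : ℕ => Set.Iic (n : ℝ≥0) := fun m n hmn =>
        Set.Iic_subset_Iic.2 (by exact_mod_cast hmn)
      have h := tendsto_measure_iUnion_atTop (μ := truncation T' g t) hmono
      have hU : ⋃ n : ℕ, Set.Iic (n : ℝ≥0) = Set.univ := by
        rw [Set.eq_univ_iff_forall]
        intro x
        obtain ⟨n, hn⟩ := exists_nat_ge x
        exact Set.mem_iUnion.2 ⟨n, hn⟩
      rwa [hU] at h
    exact measurable_of_tendsto_metrizable (fun n => hIic n) (tendsto_pi_nhds.2 hlim)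

/-- The truncated family as a finite kernel from times to energies. -/
theorem IsWeakSolution.exists_kernel (hg : IsWeakSolution T g₀ g) (hT' : T' < T) :
    ∃ κ : ProbabilityTheory.Kernel ℝ ℝ≥0, ProbabilityTheory.IsFiniteKernel κ ∧
      ∀ t, κ t = truncation T' g t := by
  obtain ⟨C, hC⟩ := hg.locally_bounded T' hT'
  refine ⟨⟨truncation T' g, hg.measurable_truncation hT'⟩, ⟨C, ENNReal.coe_lt_top, fun t => ?_⟩,
    fun t => rfl⟩
  change truncation T' g t Set.univ ≤ C
  unfold truncation
  split_ifs with h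
  · refine le_trans ?_ (hC t h)
    rw [← lintegral_one]
    exact lintegral_mono fun x => le_self_add
  · simp

theorem IsWeakSolution.measurable_cubicTerm (hg : IsWeakSolution T g₀ g) (hT' : T' < T)
    {R : ℝ} (hR : 0 < R) : Measurable fun t => cubicTerm (truncation T' g t) (profile R) := by
  obtain ⟨κ, hκ, he⟩ := hg.exists_kernel hT'
  have hfin := hg.isFiniteMeasure_truncation hT'
  have h1 : Measurable fun t =>
      ∫ p, cubicIntegrand R p ∂((ProbabilityTheory.Kernel.prod κ
        (ProbabilityTheory.Kernel.prod κ κ)) t) :=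
    (measurable_cubicIntegrand R).stronglyMeasurable.integral_kernel.measurable
  simp_rw [cubicTerm_eq hR]
  simp only [ProbabilityTheory.Kernel.prod_apply, he] at h1
  exact h1.const_mul _

theorem IsWeakSolution.measurable_quadraticTerm (hg : IsWeakSolution T g₀ g) (hT' : T' < T)
    {R : ℝ} (hR : 0 < R) :
    Measurable fun t => quadraticTerm (truncation T' g t) (profile R) := by
  obtain ⟨κ, hκ, he⟩ := hg.exists_kernel hT'
  have hfin := hg.isFiniteMeasure_truncation hT'
  have hen : ∀ t, Integrable (fun ε : ℝ≥0 => (ε : ℝ)) (truncation T' g t) := by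
    intro t
    unfold truncation
    split_ifs with h
    · exact hg.integrable_energy ⟨h.1, h.2.trans_lt hT'⟩
    · exact integrable_zero_measure
  have h1 : Measurable fun t =>
      ∫ p : ℝ≥0 × ℝ≥0, outgoingIntegral (profile R) p.1 p.2
        ∂((ProbabilityTheory.Kernel.prod κ κ) t) :=
    (measurable_outgoing R).stronglyMeasurable.integral_kernel.measurable
  simp_rw [fun t => quadraticTerm_eq (μ := truncation T' g t) hR (hen t)]
  simp only [ProbabilityTheory.Kernel.prod_apply, he] at h1
  exact h1.const_mul _

/-- The smoothed mass of `g t` in `[0, R]`. -/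
noncomputable def nearMass (g : ℝ → Measure ℝ≥0) (R t : ℝ) : ℝ := ∫ ε, profile R (ε : ℝ) ∂(g t)

/-- The total collision term tested against the profile. -/
noncomputable def collision (g : ℝ → Measure ℝ≥0) (R t : ℝ) : ℝ :=
  cubicTerm (g t) (profile R) + quadraticTerm (g t) (profile R)

theorem hasCompactSupport_profile {R : ℝ} (hR : 0 < R) :
    HasCompactSupport fun ε : ℝ≥0 => profile R ε :=
  hasCompactSupport_of_le ⟨R, hR.le⟩ fun _ hx => profile_eq_zero hR (NNReal.coe_lt_coe.2 hx).le

theorem IsWeakSolution.continuousOn_nearMass (hg : IsWeakSolution T g₀ g) {R : ℝ} (hR : 0 < R) :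
    ContinuousOn (nearMass g R) (Set.Ico 0 T) :=
  hg.continuous _ ((continuous_profile R).comp NNReal.continuous_coe)
    (hasCompactSupport_profile hR)

theorem IsWeakSolution.integrableOn_nearMass (hg : IsWeakSolution T g₀ g) (hT' : T' < T) {R : ℝ}
    (hR : 0 < R) : IntegrableOn (nearMass g R) (Set.Icc 0 T') :=
  ((hg.continuousOn_nearMass hR).mono fun _ ht => ⟨ht.1, ht.2.trans_lt hT'⟩).integrableOn_Icc

/-- The collision term is bounded on compact time intervals, with a bound that tends to zero
as `R → ∞`. -/
theorem IsWeakSolution.exists_abs_collision_le (hg : IsWeakSolution T g₀ g) (hT' : T' < T) :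
    ∃ A B : ℝ, ∀ R, 0 < R → ∀ t ∈ Set.Icc 0 T',
      |cubicTerm (g t) (profile R)| ≤ A / R ∧ |quadraticTerm (g t) (profile R)| ≤ B / √R := by
  obtain ⟨C, hC⟩ := hg.locally_bounded T' hT'
  refine ⟨4 * C ^ 3, 8 * Real.pi * (C * C), fun R hR t ht => ?_⟩
  have hfin := hg.isFiniteMeasure ⟨ht.1, ht.2.trans_lt hT'⟩
  have h1 := measureReal_univ_le (hC t ht)
  have h2 : ∫ ε, (ε : ℝ) ∂(g t) ≤ C := by
    rw [integral_energy_eq]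
    exact ENNReal.toReal_mono ENNReal.coe_ne_top (lintegral_energy_le (hC t ht))
  constructor
  · refine (abs_cubicTerm_profile_le hR).trans ?_
    rw [mul_div_right_comm]
    gcongr
  · refine (abs_quadraticTerm_profile_le hR
      (hg.integrable_energy ⟨ht.1, ht.2.trans_lt hT'⟩)).trans ?_
    have h0 : 0 ≤ ∫ ε, (ε : ℝ) ∂(g t) := integral_nonneg fun ε => ε.2
    calc _ ≤ 8 * Real.pi / √R * (C * C) := by gcongr
      _ = _ := by ring

theorem IsWeakSolution.integrableOn_cubicTerm (hg : IsWeakSolution T g₀ g) (hT' : T' < T) {R : ℝ}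
    (hR : 0 < R) : IntegrableOn (fun t => cubicTerm (g t) (profile R)) (Set.Icc 0 T') := by
  obtain ⟨A, B, hAB⟩ := hg.exists_abs_collision_le hT'
  refine IntegrableOn.of_bound (by simp) ?_ (A / R) ?_
  · refine (hg.measurable_cubicTerm hT' hR).aestronglyMeasurable.congr ?_
    filter_upwards [ae_restrict_mem measurableSet_Icc] with t ht
    rw [truncation_of_mem ht]
  · filter_upwards [ae_restrict_mem measurableSet_Icc] with t ht
    exact (hAB R hR t ht).1

theorem IsWeakSolution.integrableOn_quadraticTerm (hg : IsWeakSolution T g₀ g) (hT' : T' < T)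
    {R : ℝ} (hR : 0 < R) :
    IntegrableOn (fun t => quadraticTerm (g t) (profile R)) (Set.Icc 0 T') := by
  obtain ⟨A, B, hAB⟩ := hg.exists_abs_collision_le hT'
  refine IntegrableOn.of_bound (by simp) ?_ (B / √R) ?_
  · refine (hg.measurable_quadraticTerm hT' hR).aestronglyMeasurable.congr ?_
    filter_upwards [ae_restrict_mem measurableSet_Icc] with t ht
    rw [truncation_of_mem ht]
  · filter_upwards [ae_restrict_mem measurableSet_Icc] with t ht
    exact (hAB R hR t ht).2

theorem IsWeakSolution.integrableOn_collision (hg : IsWeakSolution T g₀ g) (hT' : T' < T) {R : ℝ}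
    (hR : 0 < R) : IntegrableOn (collision g R) (Set.Icc 0 T') :=
  (hg.integrableOn_cubicTerm hT' hR).add (hg.integrableOn_quadraticTerm hT' hR)

end Solution

/-! ### Evolution of the smoothed mass near zero -/

theorem kernel_mul_Q_eq {φ ψ : ℝ → ℝ} {r : ℝ} (h : ∀ x, 0 ≤ x → ψ x = r * φ x) {a b c : ℝ}
    (ha : 0 ≤ a) (hb : 0 ≤ b) (hc : 0 ≤ c) :
    kernel a b c * Q ψ a b c = r * (kernel a b c * Q φ a b c) := by
  rcases le_total (a + b) c with hle | hle
  · rw [kernel_eq_zero hle]; ring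
  · unfold Q
    rw [h a ha, h b hb, h c hc, h (a + b - c) (by linarith)]
    ring

/-- The cubic term only sees the values of the test function at nonnegative energies. -/
theorem cubicTerm_eq_mul {φ ψ : ℝ → ℝ} {r : ℝ} (h : ∀ x, 0 ≤ x → ψ x = r * φ x)
    (μ : Measure ℝ≥0) : cubicTerm μ ψ = r * cubicTerm μ φ := by
  unfold cubicTerm
  simp_rw [fun a b c : ℝ≥0 => kernel_mul_Q_eq h a.coe_nonneg b.coe_nonneg c.coe_nonneg,
    integral_const_mul]
  ring

/-- The quadratic term only sees the values of the test function at nonnegative energies. -/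
theorem quadraticTerm_eq_mul {φ ψ : ℝ → ℝ} {r : ℝ} (h : ∀ x, 0 ≤ x → ψ x = r * φ x)
    (μ : Measure ℝ≥0) : quadraticTerm μ ψ = r * quadraticTerm μ φ := by
  have e : ∀ a b : ℝ≥0, ∫ c in Set.Ioi (0 : ℝ), kernel (a : ℝ) b c * √c * Q ψ a b c =
      r * ∫ c in Set.Ioi (0 : ℝ), kernel (a : ℝ) b c * √c * Q φ a b c := by
    intro a b
    rw [← integral_const_mul]
    refine setIntegral_congr_fun measurableSet_Ioi fun c hc => ?_
    have := kernel_mul_Q_eq h a.coe_nonneg b.coe_nonneg (le_of_lt hc)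
    calc kernel (a : ℝ) b c * √c * Q ψ a b c = √c * (kernel (a : ℝ) b c * Q ψ a b c) := by ring
      _ = √c * (r * (kernel (a : ℝ) b c * Q φ a b c)) := by rw [this]
      _ = _ := by ring
  unfold quadraticTerm
  simp_rw [e, integral_const_mul]
  ring

/-- The profile cut off smoothly at negative energies. -/
noncomputable def cutProfile (R x : ℝ) : ℝ := profile R x * Real.smoothTransition (x + 1)

theorem cutProfile_eq {R x : ℝ} (hx : 0 ≤ x) : cutProfile R x = profile R x := by
  unfold cutProfile
  rw [Real.smoothTransition.one_of_one_le (by linarith), mul_one]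

theorem contDiff_cutProfile (R : ℝ) : ContDiff ℝ 2 (cutProfile R) :=
  (contDiff_profile R).mul ((Real.smoothTransition.contDiff (n := 2)).comp
    (contDiff_id.add contDiff_const))

theorem cutProfile_eq_zero {R x : ℝ} (hR : 0 < R) (hx : x ∉ Set.Icc (-1) R) :
    cutProfile R x = 0 := by
  unfold cutProfile
  rcases le_or_gt (-1) x with h | h
  · rw [profile_eq_zero hR, zero_mul]
    exact le_of_not_ge fun h' => hx ⟨h, h'⟩
  · rw [Real.smoothTransition.zero_of_nonpos (by linarith), mul_zero]

section Solution

variable {T T' : ℝ} {g₀ : Measure ℝ≥0} {g : ℝ → Measure ℝ≥0}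

theorem isTestFunction_mul_cutProfile {R τ : ℝ} (hR : 0 < R) (hτ : τ < T) {η : ℝ → ℝ}
    (hη : ContDiff ℝ 2 η) (hs : ∀ s, s ∉ Set.Icc (-1) τ → η s = 0) :
    IsTestFunction T fun t x => η t * cutProfile R x := by
  have hsub : Function.support (fun p : ℝ × ℝ => η p.1 * cutProfile R p.2) ⊆
      Set.Icc (-1) τ ×ˢ Set.Icc (-1) R := by
    intro p hp
    constructor
    · by_contra h
      exact hp (by simp [hs _ h])
    · by_contra h
      exact hp (by simp [cutProfile_eq_zero hR h])
  refine ⟨(hη.comp contDiff_fst).mul ((contDiff_cutProfile R).comp contDiff_snd),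
    HasCompactSupport.of_support_subset_isCompact (isCompact_Icc.prod isCompact_Icc) hsub,
    fun p hp => ?_⟩
  have := closure_minimal hsub (isClosed_Icc.prod isClosed_Icc) hp
  exact this.1.2.trans_lt hτ

/-- The weak identity for products of a function of time and the profile. -/
theorem IsWeakSolution.weak_identity_mul (hg : IsWeakSolution T g₀ g) {R τ : ℝ} (hR : 0 < R)
    (hτ : τ < T') (hT' : T' < T) {η : ℝ → ℝ} (hη : ContDiff ℝ 2 η)
    (hs : ∀ s, s ∉ Set.Icc (-1) τ → η s = 0) :
    -(η 0 * ∫ ε, profile R (ε : ℝ) ∂g₀) =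
      ∫ t in Set.Ioo 0 T', (deriv η t * nearMass g R t + η t * collision g R t) := by
  have h := hg.weak_identity _ (isTestFunction_mul_cutProfile hR (hτ.trans hT') hη hs)
  have hcut : ∀ ε : ℝ≥0, cutProfile R ε = profile R ε := fun ε => cutProfile_eq ε.2
  have hdη : Continuous (deriv η) := hη.continuous_deriv (by norm_num)
  -- the time derivative vanishes together with `η` beyond `τ`
  have hd0 : ∀ t, τ < t → deriv η t = 0 := by
    intro t ht
    have : η =ᶠ[nhds t] fun _ => 0 := by
      filter_upwards [lt_mem_nhds ht] with s hst
      exact hs s fun h => absurd h.2 (not_le.2 hst)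
    rw [this.deriv_eq, deriv_const]
  have hη0 : ∀ t, τ < t → η t = 0 := fun t ht => hs t fun h => absurd h.2 (not_le.2 ht)
  have hderiv : ∀ t (ε : ℝ≥0), deriv (fun s => η s * cutProfile R (ε : ℝ)) t =
      deriv η t * profile R ε := by
    intro t ε
    rw [deriv_mul_const ((hη.differentiable (by norm_num)).differentiableAt), hcut]
  have hcub : ∀ t, cubicTerm (g t) (fun x => η t * cutProfile R x) =
      η t * cubicTerm (g t) (profile R) := fun t =>
    cubicTerm_eq_mul (fun x hx => by rw [cutProfile_eq hx]) _
  have hquad : ∀ t, quadraticTerm (g t) (fun x => η t * cutProfile R x) =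
      η t * quadraticTerm (g t) (profile R) := fun t =>
    quadraticTerm_eq_mul (fun x hx => by rw [cutProfile_eq hx]) _
  have hcutint : ∀ f : ℝ → ℝ, (∀ t, τ < t → f t = 0) →
      ∫ t in Set.Ioo 0 T, f t = ∫ t in Set.Ioo 0 T', f t := by
    intro f hf
    refine setIntegral_eq_of_subset_of_forall_sdiff_eq_zero measurableSet_Ioo
      (Set.Ioo_subset_Ioo_right hT'.le) fun t ht => hf t ?_
    by_contra hle
    exact ht.2 ⟨ht.1.1, by linarith⟩
  simp_rw [hderiv, hcub, hquad, integral_const_mul, hcut] at h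
  have hIcc : Set.Ioo 0 T' ⊆ Set.Icc 0 T' := Set.Ioo_subset_Icc_self
  have i1 : IntegrableOn (fun t => deriv η t * nearMass g R t) (Set.Ioo 0 T') :=
    ((hg.integrableOn_nearMass hT' hR).continuousOn_mul hdη.continuousOn isCompact_Icc).mono_set
      hIcc
  have i2 : IntegrableOn (fun t => η t * cubicTerm (g t) (profile R)) (Set.Ioo 0 T') :=
    ((hg.integrableOn_cubicTerm hT' hR).continuousOn_mul hη.continuous.continuousOn
      isCompact_Icc).mono_set hIcc
  have i3 : IntegrableOn (fun t => η t * quadraticTerm (g t) (profile R)) (Set.Ioo 0 T') :=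
    ((hg.integrableOn_quadraticTerm hT' hR).continuousOn_mul hη.continuous.continuousOn
      isCompact_Icc).mono_set hIcc
  rw [hcutint _ fun t ht => by rw [hd0 t ht, zero_mul],
    hcutint _ fun t ht => by rw [hη0 t ht, zero_mul],
    hcutint _ fun t ht => by rw [hη0 t ht, zero_mul]] at h
  rw [h, integral_add i1, add_assoc]
  · congr 1
    rw [← integral_add i2 i3]
    refine integral_congr_ae (Filter.Eventually.of_forall fun t => ?_)
    simp only [collision]
    ring
  · have := i2.add i3
    refine this.congr (Filter.Eventually.of_forall fun t => ?_)
    simp only [collision, Pi.add_apply]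
    ring

end Solution

/-! ### Smooth approximations of the step function in time -/

theorem deriv_smoothTransition_eq_zero {x : ℝ} (hx : x < 0 ∨ 1 < x) :
    deriv Real.smoothTransition x = 0 := by
  rcases hx with hx | hx
  · have : Real.smoothTransition =ᶠ[nhds x] fun _ => 0 := by
      filter_upwards [gt_mem_nhds hx] with y hy
      exact Real.smoothTransition.zero_of_nonpos hy.le
    rw [this.deriv_eq, deriv_const]
  · have : Real.smoothTransition =ᶠ[nhds x] fun _ => 1 := by
      filter_upwards [lt_mem_nhds hx] with y hy
      exact Real.smoothTransition.one_of_one_le hy.le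
    rw [this.deriv_eq, deriv_const]

theorem deriv_smoothTransition_nonneg (x : ℝ) : 0 ≤ deriv Real.smoothTransition x :=
  Real.smoothTransition.monotone.deriv_nonneg

theorem continuous_deriv_smoothTransition : Continuous (deriv Real.smoothTransition) :=
  (Real.smoothTransition.contDiff (n := 1)).continuous_deriv le_rfl

/-- A smooth function of time that is `1` up to time `t` and `0` from time `t + 1 / (n + 1)` on. -/
noncomputable def timeStep (t : ℝ) (n : ℕ) (s : ℝ) : ℝ :=
  Real.smoothTransition (1 - (n + 1) * (s - t))

/-- Minus the derivative of `timeStep t n`, an approximate identity at time `t`. -/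
noncomputable def timePeak (t : ℝ) (n : ℕ) (s : ℝ) : ℝ :=
  (n + 1) * deriv Real.smoothTransition (1 - (n + 1) * (s - t))

theorem timeStep_of_le {t s : ℝ} (n : ℕ) (h : s ≤ t) : timeStep t n s = 1 :=
  Real.smoothTransition.one_of_one_le (by
    have : 0 ≤ ((n : ℝ) + 1) * (t - s) := mul_nonneg (by positivity) (by linarith)
    linarith)

theorem timeStep_of_ge {t s : ℝ} {n : ℕ} (h : 1 / ((n : ℝ) + 1) ≤ s - t) : timeStep t n s = 0 :=
  Real.smoothTransition.zero_of_nonpos (by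
    rw [div_le_iff₀ (by positivity)] at h
    linarith)

theorem hasDerivAt_timeStep (t : ℝ) (n : ℕ) (s : ℝ) :
    HasDerivAt (timeStep t n) (-timePeak t n s) s := by
  have h1 : HasDerivAt (fun s : ℝ => 1 - ((n : ℝ) + 1) * (s - t)) (-((n : ℝ) + 1)) s := by
    simpa using (((hasDerivAt_id s).sub_const t).const_mul ((n : ℝ) + 1)).const_sub 1
  have h2 : HasDerivAt Real.smoothTransition
      (deriv Real.smoothTransition (1 - ((n : ℝ) + 1) * (s - t))) (1 - ((n : ℝ) + 1) * (s - t)) :=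
    ((Real.smoothTransition.contDiff (n := 1)).differentiable
      one_ne_zero).differentiableAt.hasDerivAt
  have h3 := h2.comp s h1
  exact h3.congr_deriv (by unfold timePeak; ring)

theorem continuous_timePeak (t : ℝ) (n : ℕ) : Continuous (timePeak t n) := by
  have := continuous_deriv_smoothTransition
  unfold timePeak
  fun_prop

theorem timePeak_nonneg (t : ℝ) (n : ℕ) (s : ℝ) : 0 ≤ timePeak t n s :=
  mul_nonneg (by positivity) (deriv_smoothTransition_nonneg _)

theorem timePeak_eq_zero {t s δ : ℝ} {n : ℕ} (hn : 1 < (n + 1) * δ) (h : δ ≤ |s - t|) :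
    timePeak t n s = 0 := by
  unfold timePeak
  rw [deriv_smoothTransition_eq_zero, mul_zero]
  have hn0 : (0 : ℝ) < n + 1 := by positivity
  have hδ : 0 < δ := by
    by_contra hneg
    have := mul_nonpos_of_nonneg_of_nonpos hn0.le (not_lt.1 hneg)
    linarith
  rcases le_abs.1 h with h | h
  · left
    have := mul_le_mul_of_nonneg_left h hn0.le
    linarith
  · right
    have := mul_le_mul_of_nonneg_left h hn0.le
    linarith

/-- Integrals against the peaks tend to the value at the peak. -/
theorem tendsto_integral_timePeak_mul {t T' : ℝ} (ht : 0 < t) (htT : t < T') {f : ℝ → ℝ}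
    (hf : IntegrableOn f (Set.Ioo 0 T')) (hc : ContinuousAt f t) :
    Filter.Tendsto (fun n : ℕ => ∫ s in Set.Ioo 0 T', timePeak t n s * f s) Filter.atTop
      (nhds (f t)) := by
  have hlarge : ∀ δ : ℝ, 0 < δ → ∀ᶠ n : ℕ in Filter.atTop, 1 < ((n : ℝ) + 1) * δ := by
    intro δ hδ
    obtain ⟨N, hN⟩ := exists_nat_gt (1 / δ)
    filter_upwards [Filter.eventually_ge_atTop N] with n hn
    rw [div_lt_iff₀ hδ] at hN
    have : (N : ℝ) ≤ n := by exact_mod_cast hn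
    nlinarith
  refine tendsto_setIntegral_peak_smul_of_integrableOn_of_tendsto measurableSet_Ioo
    measurableSet_Ioo le_rfl ?_ (by simp) ?_ ?_ ?_ ?_ hf (hc.mono_left nhdsWithin_le_nhds)
  · exact self_mem_nhdsWithin
  · exact Filter.Eventually.of_forall fun n s _ => timePeak_nonneg t n s
  · intro u hu htu
    obtain ⟨δ, hδ, hball⟩ := Metric.isOpen_iff.1 hu t htu
    rw [Metric.tendstoUniformlyOn_iff]
    intro ε hε
    filter_upwards [hlarge δ hδ] with n hn s hs
    have : δ ≤ |s - t| := by
      by_contra hlt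
      exact hs.2 (hball (by rw [Metric.mem_ball, Real.dist_eq]; exact not_le.1 hlt))
    rw [timePeak_eq_zero hn this]
    simpa using hε
  · refine tendsto_const_nhds.congr' ?_
    filter_upwards [hlarge (T' - t) (by linarith)] with n hn
    have h1 := intervalIntegral.integral_eq_sub_of_hasDerivAt (a := 0) (b := T')
      (fun s _ => hasDerivAt_timeStep t n s)
      ((continuous_timePeak t n).neg.intervalIntegrable 0 T')
    rw [timeStep_of_le n ht.le, timeStep_of_ge, intervalIntegral.integral_neg,
      intervalIntegral.integral_of_le (by linarith), integral_Ioc_eq_integral_Ioo] at h1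
    · linarith
    · rw [div_le_iff₀ (by positivity)]
      linarith
  · exact Filter.Eventually.of_forall fun n => (continuous_timePeak t n).aestronglyMeasurable

section Solution

variable {T : ℝ} {g₀ : Measure ℝ≥0} {g : ℝ → Measure ℝ≥0}

/-- The weak identity integrated in time, with an integrating factor. -/
theorem IsWeakSolution.exp_mul_nearMass_eq (hg : IsWeakSolution T g₀ g) {R t : ℝ} (hR : 0 < R)
    (ht : 0 < t) (htT : t < T) (c : ℝ) :
    Real.exp (c * t) * nearMass g R t = (∫ ε, profile R (ε : ℝ) ∂g₀) +
      ∫ s in (0 : ℝ)..t, Real.exp (c * s) * (c * nearMass g R s + collision g R s) := by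
  obtain ⟨τ, htτ, hτT⟩ := exists_between htT
  obtain ⟨T', hτ', hT'⟩ := exists_between hτT
  have hIcc : Set.Ioo 0 T' ⊆ Set.Icc 0 T' := Set.Ioo_subset_Icc_self
  have hexp : Continuous fun s => Real.exp (c * s) := by fun_prop
  set f : ℝ → ℝ := fun s => Real.exp (c * s) * (c * nearMass g R s + collision g R s) with hf
  have hf_int : IntegrableOn f (Set.Ioo 0 T') := by
    have h1 : IntegrableOn (fun s => c * nearMass g R s + collision g R s) (Set.Icc 0 T') :=
      ((hg.integrableOn_nearMass hT' hR).const_mul c).add (hg.integrableOn_collision hT' hR)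
    exact (h1.continuousOn_mul hexp.continuousOn isCompact_Icc).mono_set hIcc
  set u : ℝ → ℝ := fun s => Real.exp (c * s) * nearMass g R s with hu
  have hu_int : IntegrableOn u (Set.Ioo 0 T') :=
    ((hg.integrableOn_nearMass hT' hR).continuousOn_mul hexp.continuousOn
      isCompact_Icc).mono_set hIcc
  have hu_cont : ContinuousAt u t := by
    have h1 : ContinuousAt (nearMass g R) t :=
      (hg.continuousOn_nearMass hR).continuousAt (Ico_mem_nhds ht htT)
    exact hexp.continuousAt.mul h1
  -- the first factor only makes the support compact: it equals `1` at positive times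
  set η : ℕ → ℝ → ℝ := fun n s =>
    Real.smoothTransition (s + 1) * (Real.exp (c * s) * timeStep t n s) with hη
  have hη_diff : ∀ n, ContDiff ℝ 2 (η n) := by
    intro n
    have h2 : ContDiff ℝ 2 Real.smoothTransition := Real.smoothTransition.contDiff (n := 2)
    have h3 : ContDiff ℝ 2 fun s : ℝ => 1 - ((n : ℝ) + 1) * (s - t) := by fun_prop
    have h4 : ContDiff ℝ 2 fun s : ℝ => s + 1 := by fun_prop
    have h5 : ContDiff ℝ 2 fun s : ℝ => Real.exp (c * s) := by fun_prop
    exact (h2.comp h4).mul (h5.mul (h2.comp h3))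
  have hη_deriv : ∀ n s, 0 < s →
      deriv (η n) s = Real.exp (c * s) * (c * timeStep t n s - timePeak t n s) := by
    intro n s hs
    have h1 : HasDerivAt (fun s => Real.exp (c * s)) (Real.exp (c * s) * c) s := by
      simpa using ((hasDerivAt_id s).const_mul c).exp
    have h2 := h1.mul (hasDerivAt_timeStep t n s)
    have h3 : η n =ᶠ[nhds s] fun s => Real.exp (c * s) * timeStep t n s := by
      filter_upwards [lt_mem_nhds hs] with r hr
      simp only [hη]
      rw [Real.smoothTransition.one_of_one_le (by linarith), one_mul]
    rw [h3.deriv_eq]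
    exact h2.deriv.trans (by ring)
  -- the step must end before `τ`, so that the test function is supported in `[0, T)`
  have hev : ∀ᶠ n : ℕ in Filter.atTop, 1 / ((n : ℝ) + 1) ≤ τ - t :=
    (tendsto_one_div_add_atTop_nhds_zero_nat.eventually (gt_mem_nhds (sub_pos.2 htτ))).mono
      fun _ h => h.le
  have hid : ∀ᶠ n : ℕ in Filter.atTop, ∫ s in Set.Ioo 0 T', timePeak t n s * u s =
      (∫ ε, profile R (ε : ℝ) ∂g₀) + ∫ s in Set.Ioo 0 T', timeStep t n s * f s := by
    filter_upwards [hev] with n hn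
    have h1 := hg.weak_identity_mul (η := η n) hR hτ' hT' (hη_diff n) (by
      intro s hs
      simp only [hη]
      rcases le_or_gt (-1) s with h | h
      · have : τ < s := not_le.1 fun h' => hs ⟨h, h'⟩
        rw [timeStep_of_ge (by linarith), mul_zero, mul_zero]
      · rw [Real.smoothTransition.zero_of_nonpos (by linarith), zero_mul])
    have h2 : η n 0 = 1 := by
      simp [hη, timeStep_of_le n ht.le]
    have h3 : ∫ s in Set.Ioo 0 T', (deriv (η n) s * nearMass g R s + η n s * collision g R s) =
        ∫ s in Set.Ioo 0 T', (timeStep t n s * f s - timePeak t n s * u s) := by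
      refine setIntegral_congr_fun measurableSet_Ioo fun s hs => ?_
      have h4 : η n s = Real.exp (c * s) * timeStep t n s := by
        simp only [hη]
        rw [Real.smoothTransition.one_of_one_le (by linarith [hs.1]), one_mul]
      simp only [hη_deriv n s hs.1, h4, hf, hu]
      ring
    have hcs : Continuous (timeStep t n) :=
      continuous_iff_continuousAt.2 fun s => (hasDerivAt_timeStep t n s).continuousAt
    have i1 : IntegrableOn (fun s => timeStep t n s * f s) (Set.Ioo 0 T') :=
      hf_int.continuousOn_mul_of_subset hcs.continuousOn isCompact_Icc measurableSet_Ioo hIcc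
    have i2 : IntegrableOn (fun s => timePeak t n s * u s) (Set.Ioo 0 T') :=
      hu_int.continuousOn_mul_of_subset (continuous_timePeak t n).continuousOn isCompact_Icc
        measurableSet_Ioo hIcc
    rw [h3, h2, integral_sub i1 i2] at h1
    linarith
  have hlim1 := tendsto_integral_timePeak_mul ht (htτ.trans hτ') hu_int hu_cont
  have hlim2 : Filter.Tendsto (fun n : ℕ => ∫ s in Set.Ioo 0 T', timeStep t n s * f s)
      Filter.atTop (nhds (∫ s in Set.Ioo 0 T', (Set.Iic t).indicator f s)) := by
    refine tendsto_integral_of_dominated_convergence (fun s => |f s|) (fun n => ?_) hf_int.abs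
      (fun n => ?_) ?_
    · have hcs : Continuous (timeStep t n) :=
        continuous_iff_continuousAt.2 fun s => (hasDerivAt_timeStep t n s).continuousAt
      exact hcs.aestronglyMeasurable.mul hf_int.aestronglyMeasurable
    · refine Filter.Eventually.of_forall fun s => ?_
      rw [norm_mul, Real.norm_eq_abs, Real.norm_eq_abs]
      refine mul_le_of_le_one_left (abs_nonneg _) ?_
      rw [timeStep, abs_of_nonneg (Real.smoothTransition.nonneg _)]
      exact Real.smoothTransition.le_one _
    · refine Filter.Eventually.of_forall fun s => ?_
      rcases le_or_gt s t with h | h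
      · rw [Set.indicator_of_mem (Set.mem_Iic.2 h)]
        simp [timeStep_of_le _ h]
      · rw [Set.indicator_of_notMem (by simpa using h)]
        refine tendsto_const_nhds.congr' ?_
        filter_upwards [tendsto_one_div_add_atTop_nhds_zero_nat.eventually
          (gt_mem_nhds (sub_pos.2 h))] with n hn
        rw [timeStep_of_ge hn.le, zero_mul]
  have hlim := tendsto_nhds_unique (hlim1.congr' hid) (hlim2.const_add _)
  rw [setIntegral_indicator measurableSet_Iic] at hlim
  have hset : Set.Ioo 0 T' ∩ Set.Iic t = Set.Ioc 0 t := by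
    ext s
    simp only [Set.mem_inter_iff, Set.mem_Ioo, Set.mem_Iic, Set.mem_Ioc]
    constructor
    · rintro ⟨⟨h1, _⟩, h2⟩
      exact ⟨h1, h2⟩
    · rintro ⟨h1, h2⟩
      exact ⟨⟨h1, by linarith⟩, h2⟩
  rw [hset, ← intervalIntegral.integral_of_le ht.le] at hlim
  exact hlim

end Solution

/-! ### Mass bound, almost monotonicity and growth near zero -/

section Solution

variable {T : ℝ} {g₀ : Measure ℝ≥0} {g : ℝ → Measure ℝ≥0}

theorem tendsto_integral_profile {μ : Measure ℝ≥0} [IsFiniteMeasure μ] :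
    Filter.Tendsto (fun n : ℕ => ∫ ε, profile ((n : ℝ) + 1) (ε : ℝ≥0) ∂μ) Filter.atTop
      (nhds (μ.real Set.univ)) := by
  have h1 : μ.real Set.univ = ∫ _, (1 : ℝ) ∂μ := by simp
  rw [h1]
  refine tendsto_integral_of_dominated_convergence (fun _ => 1)
    (fun n => (integrable_profile (by positivity)).aestronglyMeasurable) (integrable_const 1)
    (fun n => Filter.Eventually.of_forall fun x => ?_) (Filter.Eventually.of_forall fun x => ?_)
  · rw [Real.norm_eq_abs, abs_of_nonneg (profile_nonneg _ _)]
    exact profile_le_one (by positivity) x.2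
  · have h2 : Filter.Tendsto (fun n : ℕ => 1 - (x : ℝ) * (1 / ((n : ℝ) + 1))) Filter.atTop
        (nhds (1 - (x : ℝ) * 0)) :=
      (tendsto_one_div_add_atTop_nhds_zero_nat.const_mul (x : ℝ)).const_sub 1
    have h3 := (h2.max (tendsto_const_nhds (x := (0 : ℝ)))).pow 3
    simp only [mul_zero, sub_zero, max_eq_left zero_le_one, one_pow] at h3
    refine h3.congr fun n => ?_
    rw [profile, mul_one_div]

/-- The mass of a weak solution never exceeds the initial mass, since the collision terms tested
against the profile at scale `R` vanish as `R → ∞`. -/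
theorem IsWeakSolution.mass_le (hg : IsWeakSolution T g₀ g) [IsFiniteMeasure g₀] {t : ℝ}
    (ht : 0 < t) (htT : t < T) : (g t).real Set.univ ≤ g₀.real Set.univ := by
  have hfin := hg.isFiniteMeasure ⟨ht.le, htT⟩
  obtain ⟨A, B, hAB⟩ := hg.exists_abs_collision_le htT
  have hle : ∀ n : ℕ, ∫ ε, profile ((n : ℝ) + 1) (ε : ℝ≥0) ∂(g t) ≤
      (∫ ε, profile ((n : ℝ) + 1) (ε : ℝ≥0) ∂g₀) +
        (A / ((n : ℝ) + 1) + B / √((n : ℝ) + 1)) * t := by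
    intro n
    have hR : (0 : ℝ) < (n : ℝ) + 1 := by positivity
    have h := hg.exp_mul_nearMass_eq hR ht htT 0
    simp only [zero_mul, Real.exp_zero, one_mul, zero_add] at h
    have h2 := intervalIntegral.norm_integral_le_of_norm_le_const (a := 0) (b := t)
      (f := collision g ((n : ℝ) + 1)) (C := A / ((n : ℝ) + 1) + B / √((n : ℝ) + 1)) (by
        intro s hs
        rw [Set.uIoc_of_le ht.le] at hs
        have h3 := hAB _ hR s ⟨hs.1.le, hs.2⟩
        exact (abs_add_le _ _).trans (add_le_add h3.1 h3.2))
    rw [sub_zero, abs_of_pos ht] at h2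
    have h4 := le_of_abs_le h2
    change nearMass g _ t ≤ _
    linarith
  have hs : Filter.Tendsto (fun n : ℕ => √((n : ℝ) + 1)) Filter.atTop Filter.atTop :=
    Real.tendsto_sqrt_atTop.comp
      (Filter.tendsto_atTop_add_const_right _ 1 tendsto_natCast_atTop_atTop)
  have hn : Filter.Tendsto (fun n : ℕ => (n : ℝ) + 1) Filter.atTop Filter.atTop :=
    Filter.tendsto_atTop_add_const_right _ 1 tendsto_natCast_atTop_atTop
  have h0 : Filter.Tendsto (fun n : ℕ => (∫ ε, profile ((n : ℝ) + 1) (ε : ℝ≥0) ∂g₀) +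
      (A / ((n : ℝ) + 1) + B / √((n : ℝ) + 1)) * t) Filter.atTop
        (nhds (g₀.real Set.univ + (0 + 0) * t)) :=
    tendsto_integral_profile.add
      (((hn.const_div_atTop A).add (hs.const_div_atTop B)).mul_const t)
  have := le_of_tendsto_of_tendsto' tendsto_integral_profile h0 hle
  simpa using this

/-- The rate at which the quadratic term may deplete the neighbourhood of zero: a function of the
initial mass and energy. -/
noncomputable def lossRate (g₀ : Measure ℝ≥0) : ℝ :=
  2 * Real.pi * (2 * g₀.real Set.univ + ∫ ε, (ε : ℝ) ∂g₀)

theorem lossRate_nonneg (g₀ : Measure ℝ≥0) : 0 ≤ lossRate g₀ := by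
  have : 0 ≤ ∫ ε, (ε : ℝ) ∂g₀ := integral_nonneg fun ε => ε.2
  unfold lossRate
  positivity

/-- The smoothed mass in `[0, R]` with the exponential factor that compensates the loss. -/
noncomputable def gaugedMass (g₀ : Measure ℝ≥0) (g : ℝ → Measure ℝ≥0) (R t : ℝ) : ℝ :=
  Real.exp (lossRate g₀ * t) * nearMass g R t

theorem nearMass_nonneg (g : ℝ → Measure ℝ≥0) (R t : ℝ) : 0 ≤ nearMass g R t :=
  integral_nonneg fun _ => profile_nonneg _ _

theorem gaugedMass_nonneg (g₀ : Measure ℝ≥0) (g : ℝ → Measure ℝ≥0) (R t : ℝ) :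
    0 ≤ gaugedMass g₀ g R t :=
  mul_nonneg (Real.exp_pos _).le (nearMass_nonneg g R t)

theorem IsWeakSolution.initial_energy_ne_top (hg : IsWeakSolution T g₀ g) :
    ∫⁻ ε, (ε : ℝ≥0∞) ∂g₀ ≠ ∞ :=
  ((lintegral_mono fun _ => le_add_self).trans_lt hg.initial).ne

theorem IsWeakSolution.cubicTerm_le (hg : IsWeakSolution T g₀ g) [IsFiniteMeasure g₀]
    (hE : ∀ t ∈ Set.Ico 0 T, ∫⁻ ε, (ε : ℝ≥0∞) ∂(g t) ≤ ∫⁻ ε, (ε : ℝ≥0∞) ∂g₀)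
    {R t : ℝ} (hR : 0 < R) (hR1 : R ≤ 1) (ht : 0 < t) (htT : t < T) :
    cubicTerm (g t) (profile R) ≤ lossRate g₀ * nearMass g R t + collision g R t := by
  have hfin := hg.isFiniteMeasure ⟨ht.le, htT⟩
  have h1 := neg_le_quadraticTerm_profile (μ := g t) hR hR1 (hg.integrable_energy ⟨ht.le, htT⟩)
  have h2 : 2 * Real.pi * (2 * (g t).real Set.univ + ∫ ε, (ε : ℝ) ∂(g t)) ≤ lossRate g₀ := by
    have h3 := hg.mass_le ht htT
    have h4 : ∫ ε, (ε : ℝ) ∂(g t) ≤ ∫ ε, (ε : ℝ) ∂g₀ := by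
      rw [integral_energy_eq, integral_energy_eq]
      exact ENNReal.toReal_mono hg.initial_energy_ne_top (hE t ⟨ht.le, htT⟩)
    unfold lossRate
    gcongr
  have h5 := mul_le_mul_of_nonneg_right h2 (nearMass_nonneg g R t)
  unfold collision
  unfold nearMass at *
  linarith

theorem IsWeakSolution.intervalIntegrable_rate (hg : IsWeakSolution T g₀ g) {R s t : ℝ}
    (hR : 0 < R) (hs : 0 ≤ s) (ht : 0 ≤ t) (hsT : s < T) (htT : t < T) (c : ℝ) :
    IntervalIntegrable (fun r => Real.exp (c * r) * (c * nearMass g R r + collision g R r))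
      volume s t := by
  have hexp : Continuous fun s => Real.exp (c * s) := by fun_prop
  have h1 : IntegrableOn (fun s => c * nearMass g R s + collision g R s)
      (Set.Icc 0 (max s t)) :=
    ((hg.integrableOn_nearMass (max_lt hsT htT) hR).const_mul c).add
      (hg.integrableOn_collision (max_lt hsT htT) hR)
  refine ((h1.continuousOn_mul hexp.continuousOn isCompact_Icc).mono_set ?_).intervalIntegrable
  exact Set.Icc_subset_Icc_left (le_min hs ht)

/-- A lower bound on the cubic term translates into growth of the mass near zero. -/
theorem IsWeakSolution.gaugedMass_add_le (hg : IsWeakSolution T g₀ g) [IsFiniteMeasure g₀]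
    (hE : ∀ t ∈ Set.Ico 0 T, ∫⁻ ε, (ε : ℝ≥0∞) ∂(g t) ≤ ∫⁻ ε, (ε : ℝ≥0∞) ∂g₀)
    {R s t b : ℝ} (hR : 0 < R) (hR1 : R ≤ 1) (hs : 0 < s) (hst : s ≤ t) (htT : t < T)
    (hb : ∀ r ∈ Set.Icc s t, b ≤ Real.exp (lossRate g₀ * r) * cubicTerm (g r) (profile R)) :
    gaugedMass g₀ g R s + (t - s) * b ≤ gaugedMass g₀ g R t := by
  have h1 := hg.exp_mul_nearMass_eq hR hs (hst.trans_lt htT) (lossRate g₀)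
  have h2 := hg.exp_mul_nearMass_eq hR (hs.trans_le hst) htT (lossRate g₀)
  have i1 := hg.intervalIntegrable_rate (t := s) hR le_rfl hs.le (by linarith) (by linarith)
    (lossRate g₀)
  have i2 := hg.intervalIntegrable_rate hR hs.le (by linarith : 0 ≤ t) (by linarith) htT
    (lossRate g₀)
  have h3 := intervalIntegral.integral_add_adjacent_intervals i1 i2
  have h4 : ∫ _ in s..t, b ≤ ∫ r in s..t, Real.exp (lossRate g₀ * r) *
      (lossRate g₀ * nearMass g R r + collision g R r) := by
    refine intervalIntegral.integral_mono_on hst intervalIntegrable_const i2 fun r hr => ?_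
    refine (hb r hr).trans ?_
    gcongr
    exact hg.cubicTerm_le hE hR hR1 (by linarith [hr.1]) (by linarith [hr.2])
  rw [intervalIntegral.integral_const, smul_eq_mul] at h4
  unfold gaugedMass
  linarith

theorem IsWeakSolution.gaugedMass_mono (hg : IsWeakSolution T g₀ g) [IsFiniteMeasure g₀]
    (hE : ∀ t ∈ Set.Ico 0 T, ∫⁻ ε, (ε : ℝ≥0∞) ∂(g t) ≤ ∫⁻ ε, (ε : ℝ≥0∞) ∂g₀)
    {R s t : ℝ} (hR : 0 < R) (hR1 : R ≤ 1) (hs : 0 < s) (hst : s ≤ t) (htT : t < T) :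
    gaugedMass g₀ g R s ≤ gaugedMass g₀ g R t := by
  have := hg.gaugedMass_add_le hE (b := 0) hR hR1 hs hst htT fun r hr => by
    have := hg.isFiniteMeasure (t := r) ⟨by linarith [hr.1], by linarith [hr.2]⟩
    exact mul_nonneg (Real.exp_pos _).le (cubicTerm_profile_nonneg hR)
  linarith

theorem IsWeakSolution.initial_le_gaugedMass (hg : IsWeakSolution T g₀ g) [IsFiniteMeasure g₀]
    (hE : ∀ t ∈ Set.Ico 0 T, ∫⁻ ε, (ε : ℝ≥0∞) ∂(g t) ≤ ∫⁻ ε, (ε : ℝ≥0∞) ∂g₀)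
    {R t : ℝ} (hR : 0 < R) (hR1 : R ≤ 1) (ht : 0 < t) (htT : t < T) :
    ∫ ε, profile R (ε : ℝ) ∂g₀ ≤ gaugedMass g₀ g R t := by
  unfold gaugedMass
  rw [hg.exp_mul_nearMass_eq hR ht htT, le_add_iff_nonneg_right,
    intervalIntegral.integral_of_le ht.le]
  refine setIntegral_nonneg measurableSet_Ioc fun r hr => ?_
  have := hg.isFiniteMeasure (t := r) ⟨hr.1.le, by linarith [hr.2]⟩
  exact mul_nonneg (Real.exp_pos _).le ((cubicTerm_profile_nonneg hR).trans
    (hg.cubicTerm_le hE hR hR1 hr.1 (by linarith [hr.2])))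

theorem IsWeakSolution.gaugedMass_le_exp_mul (hg : IsWeakSolution T g₀ g) {R t : ℝ} (hR : 0 < R)
    (ht : t ∈ Set.Ico 0 T) :
    gaugedMass g₀ g R t ≤ Real.exp (lossRate g₀ * t) * (g t).real {x | (x : ℝ) ≤ R} := by
  have := hg.isFiniteMeasure ht
  exact mul_le_mul_of_nonneg_left (integral_profile_le hR) (Real.exp_pos _).le

/-- The constant in the growth estimate, with the loss over the whole time interval included. -/
noncomputable def growthConst (g₀ : Measure ℝ≥0) (T : ℝ) : ℝ :=
  cubicConst / 25 * Real.exp (-(lossRate g₀ * T)) ^ 2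

theorem growthConst_pos (g₀ : Measure ℝ≥0) (T : ℝ) : 0 < growthConst g₀ T := by
  have := cubicConst_pos
  unfold growthConst
  positivity

/-- As long as a definite part of the mass in `[0, ρ]` stays away from `[0, R]`, the mass near zero
at scale `R` is refilled at a rate proportional to the mass at scale `R / 2`. -/
theorem IsWeakSolution.growth (hg : IsWeakSolution T g₀ g) [IsFiniteMeasure g₀]
    (hE : ∀ t ∈ Set.Ico 0 T, ∫⁻ ε, (ε : ℝ≥0∞) ∂(g t) ≤ ∫⁻ ε, (ε : ℝ≥0∞) ∂g₀)
    {R ρ s t m δ : ℝ} (hR : 0 < R) (hRρ : R ≤ ρ) (hρ : ρ ≤ 1) (hs : 0 < s) (hst : s ≤ t)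
    (htT : t < T) (hδm : 0 ≤ δ * m) (hm : m ≤ gaugedMass g₀ g ρ s)
    (hno : ∀ r ∈ Set.Icc s t,
      Real.exp (lossRate g₀ * r) * (g r).real {x | (x : ℝ) ≤ R} ≤ (1 - δ) * m) :
    (t - s) * (growthConst g₀ T * (R ^ 2 * (δ * m) ^ 2 / ρ ^ 3)) * gaugedMass g₀ g (R / 2) s ≤
      gaugedMass g₀ g R t := by
  have hρ0 : 0 < ρ := hR.trans_le hRρ
  have hC := lossRate_nonneg g₀
  have key := hg.gaugedMass_add_le hE (R := R) (s := s) (t := t)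
    (b := growthConst g₀ T * (R ^ 2 * (δ * m) ^ 2 / ρ ^ 3) * gaugedMass g₀ g (R / 2) s)
    hR (hRρ.trans hρ) hs hst htT ?_
  · have := gaugedMass_nonneg g₀ g R s
    linarith
  intro r hr
  have hr0 : 0 < r := by linarith [hr.1]
  have hrT : r < T := by linarith [hr.2]
  have hfin := hg.isFiniteMeasure (t := r) ⟨hr0.le, hrT⟩
  have h1 : gaugedMass g₀ g (R / 2) s ≤
      Real.exp (lossRate g₀ * r) * (g r).real {x | (x : ℝ) ≤ R / 2} :=
    (hg.gaugedMass_mono hE (by linarith) (by linarith) hs hr.1 hrT).trans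
      (hg.gaugedMass_le_exp_mul (by linarith) ⟨hr0.le, hrT⟩)
  have h2 : m ≤ Real.exp (lossRate g₀ * r) * (g r).real {x | (x : ℝ) ≤ ρ} :=
    hm.trans ((hg.gaugedMass_mono hE hρ0 hρ hs hr.1 hrT).trans
      (hg.gaugedMass_le_exp_mul hρ0 ⟨hr0.le, hrT⟩))
  have h3 : (g r).real {x | (x : ℝ) ≤ ρ} ≤ (g r).real {x | (x : ℝ) ≤ R} +
      (g r).real {x | R < (x : ℝ) ∧ (x : ℝ) ≤ ρ} := by
    refine (measureReal_mono ?_ (by finiteness)).trans (measureReal_union_le _ _)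
    intro x hx
    rcases le_or_gt (x : ℝ) R with h | h
    · exact Or.inl h
    · exact Or.inr ⟨h, hx⟩
  have hexp : 0 < Real.exp (lossRate g₀ * r) := Real.exp_pos _
  have h4 : δ * m ≤ Real.exp (lossRate g₀ * r) *
      (g r).real {x | R < (x : ℝ) ∧ (x : ℝ) ≤ ρ} := by
    have h5 := mul_le_mul_of_nonneg_left h3 hexp.le
    have h6 := hno r hr
    linarith
  have h5 : Real.exp (-(lossRate g₀ * T)) * (δ * m) ≤
      (g r).real {x | R < (x : ℝ) ∧ (x : ℝ) ≤ ρ} := by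
    have h6 : Real.exp (-(lossRate g₀ * T)) ≤ Real.exp (-(lossRate g₀ * r)) := by
      gcongr
    calc _ ≤ Real.exp (-(lossRate g₀ * r)) * (Real.exp (lossRate g₀ * r) *
          (g r).real {x | R < (x : ℝ) ∧ (x : ℝ) ≤ ρ}) := by gcongr
      _ = _ := by rw [← mul_assoc, ← Real.exp_add, neg_add_cancel, Real.exp_zero, one_mul]
  have h6 := le_cubicTerm_profile (μ := g r) hR hRρ (by positivity) h5
  have hc := cubicConst_pos
  calc growthConst g₀ T * (R ^ 2 * (δ * m) ^ 2 / ρ ^ 3) * gaugedMass g₀ g (R / 2) s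
      ≤ growthConst g₀ T * (R ^ 2 * (δ * m) ^ 2 / ρ ^ 3) *
        (Real.exp (lossRate g₀ * r) * (g r).real {x | (x : ℝ) ≤ R / 2}) := by
        have := growthConst_pos g₀ T
        gcongr
    _ = Real.exp (lossRate g₀ * r) * (cubicConst / 25 *
        (R ^ 2 * (Real.exp (-(lossRate g₀ * T)) * (δ * m)) ^ 2 / ρ ^ 3) *
          (g r).real {x | (x : ℝ) ≤ R / 2}) := by
        unfold growthConst
        ring
    _ ≤ _ := by gcongr

/-- If two rounds of growth starting from the initial mass at scale `R / 4` would produce more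
than the total mass, then most of the mass in `[0, ρ]` must have entered `[0, R]`. -/
theorem IsWeakSolution.concentration_step (hg : IsWeakSolution T g₀ g) [IsFiniteMeasure g₀]
    (hE : ∀ t ∈ Set.Ico 0 T, ∫⁻ ε, (ε : ℝ≥0∞) ∂(g t) ≤ ∫⁻ ε, (ε : ℝ≥0∞) ∂g₀)
    {R ρ' ρ s t m δ : ℝ} (hR : 0 < R) (hRρ : R ≤ ρ) (hρ : ρ ≤ 1) (hRρ' : R ≤ ρ') (hρ' : ρ' ≤ 1)
    (hs : 0 < s) (hst : s ≤ t) (htT : t < T) (hδm : 0 ≤ δ * m) (hm : m ≤ gaugedMass g₀ g ρ s)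
    (hbig : Real.exp (lossRate g₀ * T) * g₀.real Set.univ <
      ((t - s) / 2 * (growthConst g₀ T * ((R / 2) ^ 2 * (δ * m) ^ 2 / ρ ^ 3))) ^ 2 *
        ∫ ε, profile (R / 4) (ε : ℝ) ∂g₀) :
    (1 - R / ρ') ^ 3 * ((1 - δ) * m) ≤ gaugedMass g₀ g ρ' t := by
  have hρ0 : 0 < ρ := hR.trans_le hRρ
  have hρ'0 : 0 < ρ' := hR.trans_le hRρ'
  have hk := growthConst_pos g₀ T
  have hC := lossRate_nonneg g₀
  by_cases hno : ∀ r ∈ Set.Icc s t,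
      Real.exp (lossRate g₀ * r) * (g r).real {x | (x : ℝ) ≤ R} ≤ (1 - δ) * m
  · exfalso
    -- the first round, at scale `R / 2`, lasts until the midpoint `q`; the second is at scale `R`
    set q : ℝ := (s + t) / 2 with hq
    have hsq : s ≤ q := by rw [hq]; linarith
    have hqt : q ≤ t := by rw [hq]; linarith
    have h1 := hg.growth hE (R := R / 2) (t := q) (by linarith) (by linarith) hρ hs hsq
      (by linarith) hδm hm (by
        intro r hr
        have := hg.isFiniteMeasure (t := r) ⟨by linarith [hr.1], by linarith [hr.2]⟩
        refine le_trans ?_ (hno r ⟨hr.1, by linarith [hr.2]⟩)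
        refine mul_le_mul_of_nonneg_left (measureReal_mono ?_ (by finiteness)) (Real.exp_pos _).le
        intro x (hx : (x : ℝ) ≤ R / 2)
        exact hx.trans (by linarith))
    have h2 := hg.growth hE (s := q) hR hRρ hρ (by linarith) hqt htT hδm
      (hm.trans (hg.gaugedMass_mono hE hρ0 hρ hs hsq (by linarith)))
      (fun r hr => hno r ⟨by linarith [hr.1], hr.2⟩)
    have h3 := hg.initial_le_gaugedMass hE (R := R / 2 / 2) (by linarith) (by linarith) hs
      (by linarith)
    have h4 : gaugedMass g₀ g R t ≤ Real.exp (lossRate g₀ * T) * g₀.real Set.univ := by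
      refine (hg.gaugedMass_le_exp_mul hR ⟨by linarith, htT⟩).trans ?_
      have := hg.isFiniteMeasure (t := t) ⟨by linarith, htT⟩
      have h5 : (g t).real {x | (x : ℝ) ≤ R} ≤ g₀.real Set.univ :=
        (measureReal_mono (Set.subset_univ _) (by finiteness)).trans
          (hg.mass_le (by linarith) htT)
      gcongr
    rw [show q - s = (t - s) / 2 by rw [hq]; ring] at h1
    rw [show t - q = (t - s) / 2 by rw [hq]; ring] at h2
    rw [show R / 2 / 2 = R / 4 by ring] at h1 h3
    set G : ℝ := (t - s) / 2 * (growthConst g₀ T * ((R / 2) ^ 2 * (δ * m) ^ 2 / ρ ^ 3)) with hG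
    have hts : 0 ≤ (t - s) / 2 := by linarith
    have hG0 : 0 ≤ G := by positivity
    have hGle : G ≤ (t - s) / 2 * (growthConst g₀ T * (R ^ 2 * (δ * m) ^ 2 / ρ ^ 3)) := by
      rw [hG]
      gcongr
      linarith
    have h6 : G ^ 2 * ∫ ε, profile (R / 4) (ε : ℝ) ∂g₀ ≤ gaugedMass g₀ g R t := by
      calc G ^ 2 * ∫ ε, profile (R / 4) (ε : ℝ) ∂g₀
          ≤ G ^ 2 * gaugedMass g₀ g (R / 4) s := by gcongr
        _ = G * (G * gaugedMass g₀ g (R / 4) s) := by ring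
        _ ≤ G * gaugedMass g₀ g (R / 2) q := by gcongr
        _ ≤ _ := (mul_le_mul_of_nonneg_right hGle (gaugedMass_nonneg _ _ _ _)).trans h2
    linarith
  · push Not at hno
    obtain ⟨r, hr, hlt⟩ := hno
    have hr0 : 0 < r := by linarith [hr.1]
    have hrT : r < T := by linarith [hr.2]
    have hfin := hg.isFiniteMeasure (t := r) ⟨hr0.le, hrT⟩
    refine le_trans ?_ (hg.gaugedMass_mono hE hρ'0 hρ' hr0 hr.2 htT)
    have h0 : 0 ≤ 1 - R / ρ' := by rw [sub_nonneg, div_le_one hρ'0]; exact hRρ'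
    calc (1 - R / ρ') ^ 3 * ((1 - δ) * m)
        ≤ (1 - R / ρ') ^ 3 *
          (Real.exp (lossRate g₀ * r) * (g r).real {x | (x : ℝ) ≤ R}) := by gcongr
      _ = Real.exp (lossRate g₀ * r) *
          ((1 - R / ρ') ^ 3 * (g r).real {x | (x : ℝ) ≤ R}) := by ring
      _ ≤ _ := mul_le_mul_of_nonneg_left (le_integral_profile hρ'0 hRρ') (Real.exp_pos _).le

end Solution

/-! ### Iteration over scales and condensation -/

theorem half_le_measureReal {μ : Measure ℝ≥0} [IsFiniteMeasure μ] {A : Set ℝ≥0} {b : ℝ}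
    (hb : 0 < b) (h : 1 / 2 < μ A / ENNReal.ofReal b) : b / 2 ≤ μ.real A := by
  rw [ENNReal.lt_div_iff_mul_lt (Or.inl (by simpa using hb)) (Or.inl ENNReal.ofReal_ne_top)] at h
  have h1 := ENNReal.toReal_mono (measure_ne_top μ A) h.le
  rw [ENNReal.toReal_mul, ENNReal.toReal_ofReal hb.le] at h1
  norm_num at h1
  unfold Measure.real
  linarith

/-- Up to a factor `1 / 2`, the supremum in the concentration condition is attained. -/
theorem Concentrated.exists_scale {θ ν ρ₀ K : ℝ} {g₀ : Measure ℝ≥0} [IsFiniteMeasure g₀]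
    (hν : 0 < ν) (hK : 0 < K) (h : Concentrated θ ν ρ₀ K g₀) :
    ∃ ρ ∈ Set.Ioc 0 ρ₀,
      (∀ R ∈ Set.Ioc 0 ρ, ν * R ^ (3 / 2 : ℝ) / 2 ≤ g₀.real {ε | (ε : ℝ) ≤ R}) ∧
        K * ρ ^ θ / 2 ≤ g₀.real {ε | (ε : ℝ) ≤ ρ} := by
  have h1 : (1 / 2 : ℝ≥0∞) < 1 := ENNReal.half_lt_self one_ne_zero ENNReal.one_ne_top
  obtain ⟨ρ, h2⟩ := lt_iSup_iff.1 (h1.trans_le h)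
  obtain ⟨hρ, h3⟩ := lt_iSup_iff.1 h2
  obtain ⟨h4, h5⟩ := lt_min_iff.1 h3
  refine ⟨ρ, hρ, fun R hR => ?_, ?_⟩
  · exact half_le_measureReal (mul_pos hν (Real.rpow_pos_of_pos hR.1 _))
      (h4.trans_le (iInf₂_le R hR))
  · exact half_le_measureReal (mul_pos hK (Real.rpow_pos_of_pos hρ.1 _)) h5

section Solution

variable {T : ℝ} {g₀ : Measure ℝ≥0} {g : ℝ → Measure ℝ≥0}

/-- The gain in two rounds of growth at scale `x ^ 44`: the power `x⁻¹` left over beats any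
constant. The exponent `44` is what makes the powers of `x` combine to a negative one. -/
theorem gain_bound {x m σ k ν S : ℝ} (hx : 0 < x) (hxσ : x ≤ σ) (hm : σ ≤ m) (hk : 0 < k)
    (hν : 0 < ν) (hS : ν * x ^ 69 / 16 ≤ S) :
    4 * k ^ 2 * ν / x ≤
      (x / 2 * (k * ((8 * x ^ 46 / 2) ^ 2 * (x * m) ^ 2 / (x ^ 44) ^ 3))) ^ 2 * S := by
  have hxm : x ≤ m := hxσ.trans hm
  have h1 : x / 2 * (k * ((8 * x ^ 46 / 2) ^ 2 * (x * x) ^ 2 / (x ^ 44) ^ 3)) ≤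
      x / 2 * (k * ((8 * x ^ 46 / 2) ^ 2 * (x * m) ^ 2 / (x ^ 44) ^ 3)) := by gcongr
  calc 4 * k ^ 2 * ν / x
      = (x / 2 * (k * ((8 * x ^ 46 / 2) ^ 2 * (x * x) ^ 2 / (x ^ 44) ^ 3))) ^ 2 *
        (ν * x ^ 69 / 16) := by
        field_simp
        ring
    _ ≤ _ := by gcongr

/-- One step of the iteration, from scale `x ^ 44` to scale `(x / 2) ^ 44` within time `x`. -/
theorem IsWeakSolution.iteration_step (hg : IsWeakSolution T g₀ g) [IsFiniteMeasure g₀]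
    (hE : ∀ t ∈ Set.Ico 0 T, ∫⁻ ε, (ε : ℝ≥0∞) ∂(g t) ≤ ∫⁻ ε, (ε : ℝ≥0∞) ∂g₀)
    {x σ ν s m : ℝ} (hx : 0 < x) (hxσ : x ≤ σ) (hσ : 2 ^ 47 * σ ≤ 1) (hν : 0 < ν) (hs : 0 < s)
    (hsT : s + x < T) (hσm : σ ≤ m) (hm2 : m ≤ 2 * σ) (hm : m ≤ gaugedMass g₀ g (x ^ 44) s)
    (hseed : ν * x ^ 69 / 2 ≤ g₀.real {ε | (ε : ℝ) ≤ x ^ 46})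
    (hsmall : σ * (Real.exp (lossRate g₀ * T) * g₀.real Set.univ) <
      4 * growthConst g₀ T ^ 2 * ν) :
    m - 8 * σ * x ≤ gaugedMass g₀ g ((x / 2) ^ 44) (s + x) := by
  have hx1 : 2 ^ 47 * x ≤ 1 := (mul_le_mul_of_nonneg_left hxσ (by positivity)).trans hσ
  have hxle : x ≤ 1 := by linarith
  have hk := growthConst_pos g₀ T
  have hm0 : 0 < m := by linarith
  have hx2 : x ^ 46 = x ^ 44 * x ^ 2 := by ring
  have hxx : x ^ 2 ≤ x * 1 := by rw [sq]; gcongr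
  have h44 : 0 < x ^ 44 := by positivity
  have hR1 : 8 * x ^ 46 ≤ x ^ 44 := by
    rw [hx2]
    have : 8 * x ^ 2 ≤ 1 := by linarith
    nlinarith
  have hratio : 8 * x ^ 46 / (x / 2) ^ 44 = 2 ^ 47 * x * x := by
    field_simp
    norm_num
  have hratio' : 8 * x ^ 46 / (x / 2) ^ 44 ≤ x := by
    rw [hratio]
    exact mul_le_of_le_one_left hx.le hx1
  have hR2 : 8 * x ^ 46 ≤ (x / 2) ^ 44 := by
    rw [div_le_iff₀ (by positivity)] at hratio'
    exact hratio'.trans (mul_le_of_le_one_left (by positivity) hxle)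
  have hS : ν * x ^ 69 / 16 ≤ ∫ ε, profile (8 * x ^ 46 / 4) (ε : ℝ) ∂g₀ := by
    have h := le_integral_profile (μ := g₀) (r := x ^ 46) (R := 8 * x ^ 46 / 4) (by positivity)
      (by linarith [(by positivity : 0 < x ^ 46)])
    have e : (1 - x ^ 46 / (8 * x ^ 46 / 4)) ^ 3 = 1 / 8 := by
      have : x ^ 46 / (8 * x ^ 46 / 4) = 1 / 2 := by
        field_simp
        norm_num
      rw [this]
      norm_num
    rw [e] at h
    linarith
  have key := hg.concentration_step hE (R := 8 * x ^ 46) (ρ := x ^ 44) (ρ' := (x / 2) ^ 44)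
    (s := s) (t := s + x) (m := m) (δ := x) (by positivity) hR1 (pow_le_one₀ hx.le hxle) hR2
    (pow_le_one₀ (by positivity) (by linarith)) hs (by linarith) hsT (by positivity) hm ?_
  · refine le_trans ?_ key
    have h1 : (1 - x) ^ 3 ≤ (1 - 8 * x ^ 46 / (x / 2) ^ 44) ^ 3 := by
      have : 0 ≤ 1 - x := by linarith
      gcongr
    -- Bernoulli's inequality for the product of the two losses
    have h2 : 1 - 4 * x ≤ (1 - x) ^ 4 := by
      have := one_add_mul_le_pow (a := -x) (by linarith) 4
      norm_num at this
      calc 1 - 4 * x ≤ (1 + -x) ^ 4 := by linarith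
        _ = (1 - x) ^ 4 := by ring
    have h3 : 0 ≤ (1 - x) * m := mul_nonneg (by linarith) hm0.le
    calc m - 8 * σ * x ≤ (1 - 4 * x) * m := by nlinarith
      _ ≤ (1 - x) ^ 4 * m := by gcongr
      _ = (1 - x) ^ 3 * ((1 - x) * m) := by ring
      _ ≤ _ := by gcongr
  · rw [add_sub_cancel_left]
    refine lt_of_lt_of_le ?_ (gain_bound hx hxσ hσm hk hν hS)
    rw [lt_div_iff₀ hx, mul_comm]
    refine lt_of_le_of_lt ?_ hsmall
    gcongr

/-- The smoothed mass at the scales `(σ / 2 ^ k) ^ 44` stays bounded below along the times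
`3 σ - 2 σ / 2 ^ k`. -/
theorem IsWeakSolution.iteration (hg : IsWeakSolution T g₀ g) [IsFiniteMeasure g₀]
    (hE : ∀ t ∈ Set.Ico 0 T, ∫⁻ ε, (ε : ℝ≥0∞) ∂(g t) ≤ ∫⁻ ε, (ε : ℝ≥0∞) ∂g₀)
    {σ ν : ℝ} (hσ0 : 0 < σ) (hσ : 2 ^ 47 * σ ≤ 1) (hν : 0 < ν) (hσT : 3 * σ < T)
    (hinit : 2 * σ ≤ ∫ ε, profile (σ ^ 44) (ε : ℝ) ∂g₀)
    (hseed : ∀ x, 0 < x → x ≤ σ → ν * x ^ 69 / 2 ≤ g₀.real {ε | (ε : ℝ) ≤ x ^ 46})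
    (hsmall : σ * (Real.exp (lossRate g₀ * T) * g₀.real Set.univ) <
      4 * growthConst g₀ T ^ 2 * ν) (k : ℕ) :
    2 * σ * (1 - 8 * σ + 8 * (σ / 2 ^ k)) ≤
      gaugedMass g₀ g ((σ / 2 ^ k) ^ 44) (3 * σ - 2 * (σ / 2 ^ k)) := by
  induction k with
  | zero =>
    simp only [pow_zero, div_one]
    have := hg.initial_le_gaugedMass hE (R := σ ^ 44) (t := 3 * σ - 2 * σ) (by positivity)
      (pow_le_one₀ hσ0.le (by linarith)) (by linarith) (by linarith)
    linarith
  | succ k ih =>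
    have hx : 0 < σ / 2 ^ k := by positivity
    have hxσ : σ / 2 ^ k ≤ σ := div_le_self hσ0.le (one_le_pow₀ one_le_two)
    have hhalf : σ / 2 ^ (k + 1) = σ / 2 ^ k / 2 := by rw [pow_succ, div_div]
    rw [hhalf]
    generalize σ / 2 ^ k = x at *
    have h := hg.iteration_step hE hx hxσ hσ hν (s := 3 * σ - 2 * x)
      (m := 2 * σ * (1 - 8 * σ + 8 * x)) (by linarith) (by linarith) (by nlinarith) (by nlinarith)
      ih (hseed x hx hxσ) hsmall
    rw [show 3 * σ - 2 * x + x = 3 * σ - 2 * (x / 2) by ring] at h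
    linarith

/-- Mass in arbitrarily small neighbourhoods of zero yields an atom at zero. -/
theorem pos_measure_zero {μ : Measure ℝ≥0} [IsFiniteMeasure μ] {a : ℝ} (ha : 0 < a)
    {r : ℕ → ℝ} (hr : Filter.Tendsto r Filter.atTop (nhds 0)) (hanti : Antitone r)
    (h : ∀ k, a ≤ μ.real {x | (x : ℝ) ≤ r k}) : 0 < μ {0} := by
  have hmeas : ∀ k, NullMeasurableSet {x : ℝ≥0 | (x : ℝ) ≤ r k} μ := fun k =>
    (measurableSet_le (by fun_prop) measurable_const).nullMeasurableSet
  have hlim := tendsto_measure_iInter_atTop (μ := μ) hmeas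
    (fun i j hij x (hx : (x : ℝ) ≤ r j) => hx.trans (hanti hij)) ⟨0, by finiteness⟩
  have hr0 : ∀ k, 0 ≤ r k := fun k => hanti.le_of_tendsto hr k
  have hset : ⋂ k, {x : ℝ≥0 | (x : ℝ) ≤ r k} = {0} := by
    ext x
    simp only [Set.mem_iInter, Set.mem_ofPred_eq, Set.mem_singleton_iff]
    constructor
    · intro hx
      have : (x : ℝ) ≤ 0 := ge_of_tendsto' hr hx
      exact le_antisymm (by exact_mod_cast this) zero_le
    · rintro rfl k
      simpa using hr0 k
  rw [hset] at hlim
  have hle : ENNReal.ofReal a ≤ μ {0} := by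
    refine ge_of_tendsto' hlim fun k => ?_
    exact (ENNReal.ofReal_le_iff_le_toReal (measure_ne_top μ _)).2 (h k)
  exact (ENNReal.ofReal_pos.2 ha).trans_le hle

/-- Quantitative condensation: at time `1 / 2` there is an atom at zero energy. -/
theorem IsWeakSolution.pos_atom (hg : IsWeakSolution 1 g₀ g) [IsFiniteMeasure g₀]
    (hE : ∀ t ∈ Set.Ico (0 : ℝ) 1, ∫⁻ ε, (ε : ℝ≥0∞) ∂(g t) ≤ ∫⁻ ε, (ε : ℝ≥0∞) ∂g₀)
    {σ ν : ℝ} (hσ0 : 0 < σ) (hσ : 2 ^ 47 * σ ≤ 1) (hν : 0 < ν)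
    (hinit : 2 * σ ≤ ∫ ε, profile (σ ^ 44) (ε : ℝ) ∂g₀)
    (hseed : ∀ x, 0 < x → x ≤ σ → ν * x ^ 69 / 2 ≤ g₀.real {ε | (ε : ℝ) ≤ x ^ 46})
    (hsmall : σ * (Real.exp (lossRate g₀ * 1) * g₀.real Set.univ) <
      4 * growthConst g₀ 1 ^ 2 * ν) : 0 < g (1 / 2) {0} := by
  have hfin := hg.isFiniteMeasure (t := 1 / 2) ⟨by norm_num, by norm_num⟩
  have hpow : Antitone fun k : ℕ => σ / 2 ^ k := fun i j hij => by
    change σ / 2 ^ j ≤ σ / 2 ^ i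
    gcongr
    norm_num
  have hpow0 : Filter.Tendsto (fun k : ℕ => σ / 2 ^ k) Filter.atTop (nhds 0) :=
    (tendsto_pow_atTop_atTop_of_one_lt one_lt_two).const_div_atTop σ
  have hexp : 0 < Real.exp (lossRate g₀ * (1 / 2)) := Real.exp_pos _
  refine pos_measure_zero (a := σ / Real.exp (lossRate g₀ * (1 / 2))) (by positivity)
    (r := fun k => (σ / 2 ^ k) ^ 44) ?_ ?_ fun k => ?_
  · simpa using hpow0.pow 44
  · intro i j hij
    exact pow_le_pow_left₀ (by positivity) (hpow hij) 44
  · have hx : 0 < σ / 2 ^ k := by positivity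
    have hxσ : σ / 2 ^ k ≤ σ := div_le_self hσ0.le (one_le_pow₀ one_le_two)
    have h1 := hg.iteration hE hσ0 hσ hν (by linarith) hinit hseed hsmall k
    have h2 := hg.gaugedMass_mono hE (R := (σ / 2 ^ k) ^ 44) (s := 3 * σ - 2 * (σ / 2 ^ k))
      (t := 1 / 2) (by positivity) (pow_le_one₀ hx.le (by linarith)) (by linarith) (by linarith)
      (by norm_num)
    have h3 := hg.gaugedMass_le_exp_mul (R := (σ / 2 ^ k) ^ 44) (t := 1 / 2) (by positivity)
      ⟨by norm_num, by norm_num⟩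
    rw [div_le_iff₀ hexp, mul_comm]
    refine le_trans ?_ (h1.trans (h2.trans h3))
    nlinarith

end Solution

end Nordheim

theorem theorem2p3 :
    ∃ θ : ℝ, 0 < θ ∧
      ∀ M E : ℝ, 0 < M → 0 < E →
        ∃ T₀ : ℝ, 0 < T₀ ∧
          ∀ ν : ℝ, 0 < ν →
            ∃ ρ₀ K : ℝ, 0 < ρ₀ ∧ 0 < K ∧
              ∀ (g₀ : Measure ℝ≥0) (g : ℝ → Measure ℝ≥0),
                Nordheim.IsWeakSolution T₀ g₀ g →
                (∀ t ∈ Set.Ico 0 T₀,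
                  ∫⁻ ε, (ε : ℝ≥0∞) ∂(g t) ≤ ∫⁻ ε, (ε : ℝ≥0∞) ∂g₀) →
                4 * Real.pi * √2 * g₀.real Set.univ = M →
                4 * Real.pi * √2 * ∫ ε, (ε : ℝ) ∂g₀ = E →
                Nordheim.Concentrated θ ν ρ₀ K g₀ →
                0 < ⨆ t ∈ Set.Ioo 0 T₀, g t {0} := by
  refine ⟨1 / 44, by norm_num, fun M E hM hE => ⟨1, one_pos, fun ν hν => ?_⟩⟩
  have hc : 0 < 4 * Real.pi * √2 := by positivity
  -- the loss rate and the growth constant, expressed through `M` and `E`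
  set C : ℝ := 2 * Real.pi * (2 * (M / (4 * Real.pi * √2)) + E / (4 * Real.pi * √2)) with hC
  set k : ℝ := Nordheim.cubicConst / 25 * Real.exp (-(C * 1)) ^ 2 with hk
  have hk0 : 0 < k := by
    have := Nordheim.cubicConst_pos
    positivity
  set B : ℝ := Real.exp (C * 1) * (M / (4 * Real.pi * √2)) with hB
  have hB0 : 0 < B := by positivity
  set σ₀ : ℝ := min (1 / 2 ^ 47) (4 * k ^ 2 * ν / (2 * B)) with hσ₀
  have hσ₀0 : 0 < σ₀ := lt_min (by positivity) (by positivity)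
  refine ⟨σ₀ ^ 44 / 2, 64, by positivity, by norm_num, fun g₀ g hg hen hmass henergy hconc => ?_⟩
  have hm : g₀.real Set.univ = M / (4 * Real.pi * √2) := by
    rw [eq_div_iff hc.ne', mul_comm]
    exact hmass
  have he : ∫ ε, (ε : ℝ) ∂g₀ = E / (4 * Real.pi * √2) := by
    rw [eq_div_iff hc.ne', mul_comm]
    exact henergy
  have hloss : Nordheim.lossRate g₀ = C := by rw [Nordheim.lossRate, hm, he]
  have hgrowth : Nordheim.growthConst g₀ 1 = k := by rw [Nordheim.growthConst, hloss]
  have hfin : IsFiniteMeasure g₀ := by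
    refine ⟨lt_of_le_of_lt ?_ hg.initial⟩
    rw [← lintegral_one]
    exact lintegral_mono fun x => le_self_add
  obtain ⟨ρ, hρ, hseed, hinit⟩ := hconc.exists_scale hν (by norm_num)
  -- the base scale `σ` is chosen with `σ ^ 44 = 2 ρ`
  set σ : ℝ := (2 * ρ) ^ (1 / 44 : ℝ) with hσ
  have hρ0 : 0 < ρ := hρ.1
  have hσ0 : 0 < σ := Real.rpow_pos_of_pos (by linarith) _
  have hσ44 : σ ^ 44 = 2 * ρ := by
    rw [hσ, ← Real.rpow_natCast, ← Real.rpow_mul (by linarith)]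
    norm_num
  have hσle : σ ≤ σ₀ := by
    refine le_of_pow_le_pow_left₀ (n := 44) (by norm_num) hσ₀0.le ?_
    rw [hσ44]
    linarith [hρ.2]
  have hσ47 : 2 ^ 47 * σ ≤ 1 := by
    have := hσle.trans (min_le_left _ _)
    rwa [le_div_iff₀ (by positivity), mul_comm] at this
  have hatom : 0 < g (1 / 2) {0} := by
    refine hg.pos_atom hen hσ0 hσ47 hν ?_ ?_ ?_
    · have h1 := Nordheim.le_integral_profile (μ := g₀) (r := ρ) (R := 2 * ρ) (by linarith)
        (by linarith)
      have h2 : ρ / (2 * ρ) = 1 / 2 := by field_simp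
      have h3 : σ ≤ 2 * ρ ^ (1 / 44 : ℝ) := by
        rw [hσ, Real.mul_rpow (by norm_num) hρ0.le]
        gcongr
        exact Real.rpow_le_self_of_one_le (by norm_num) (by norm_num)
      rw [hσ44]
      rw [h2] at h1
      norm_num at h1
      norm_num at hinit h3
      linarith
    · intro x hx hxσ
      have h1 : x ^ 46 ≤ ρ := by
        have h2 : x ^ 44 ≤ 2 * ρ := by
          rw [← hσ44]
          gcongr
        have h3 : x ^ 2 ≤ 1 / 2 := by nlinarith
        calc x ^ 46 = x ^ 44 * x ^ 2 := by ring
          _ ≤ 2 * ρ * (1 / 2) := by gcongr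
          _ = ρ := by ring
      have h4 := hseed (x ^ 46) ⟨by positivity, h1⟩
      have h5 : (x ^ 46) ^ (3 / 2 : ℝ) = x ^ 69 := by
        rw [← Real.rpow_natCast, ← Real.rpow_natCast, ← Real.rpow_mul hx.le]
        norm_num
      rwa [h5] at h4
    · rw [hloss, hgrowth, hm]
      have h1 := hσle.trans (min_le_right _ _)
      rw [le_div_iff₀ (by positivity)] at h1
      have h2 : 0 < 4 * k ^ 2 * ν := by positivity
      change σ * B < _
      nlinarith
  refine hatom.trans_le ?_
  exact le_iSup₂ (f := fun t (_ : t ∈ Set.Ioo (0 : ℝ) 1) => g t {0}) (1 / 2 : ℝ)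
    ⟨by norm_num, by norm_num⟩
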